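/- Let $M$ be a connected, Hausdorff, paracompact smooth manifold of finite dimension (non-empty, without boundary), let $k\in\mathbb N\cup\{\infty\}$, and let $\mathfrak k$ be a finite-dimensional real Lie algebra. Let $\pi\colon\mathbb L\to M$ be a smooth bundle of Lie algebras with fiber $\mathfrak k$, i.e. a smooth real vector bundle whose fibers $\mathbb L_x$ are Lie algebras and which has a smooth bundle atlas whose charts restrict on every fiber to isomorphisms of Lie algebras $\mathbb L_x\to\mathfrak k$. Let $\Gamma^k(\mathbb L)$ be the real Lie algebra of $C^k$-sections of $\mathbb L$ with the pointwise bracket. A complex structure on a real Lie algebra $\mathfrak g$ is an $\mathbb R$-linear map $J\colon\mathfrak g\to\mathfrak g$ with $J^2=-\mathbf 1$ and $J[x,y]=[x,Jy]$ for all $x,y\in\mathfrak g$. Suppose that $\mathfrak k$ is indecomposable, i.e. not the direct sum of two proper ideals, and that the only Lie algebra morphism $\mathfrak k/[\mathfrak k,\mathfrak k]\to\mathfrak z(\mathfrak k)$ into the center of $\mathfrak k$ is $0$. Then: 1. $\Gamma^k(\mathbb L)$ admits at most two complex structures; if $J$ is one of them, then $J$ and $-J$ are all of them. 2. If the first Čech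 cohomology $\check H^1(M,\mathbb Z/2\mathbb Z)$ (with values in the discrete group $\mathbb Z/2\mathbb Z$) is trivial, then $\Gamma^k(\mathbb L)$ admits a complex structure if and only if $\mathfrak k$ does. -/

import Mathlib

open Bundle Manifold ContDiff TopologicalSpace

/-! ### Algebraic notions -/

/-- `J` is a complex structure on the real Lie algebra `𝔤`: an `ℝ`-linear endomorphism with
`J² = -1` that is compatible with the bracket, i.e. lies in the centroid of `𝔤`. -/
def IsLieComplexStructure {𝔤 : Type*} [LieRing 𝔤] [LieAlgebra ℝ 𝔤] (J : 𝔤 →ₗ[ℝ] 𝔤) : Prop :=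
  (∀ x y : 𝔤, J ⁅x, y⁆ = ⁅x, J y⁆) ∧ ∀ x : 𝔤, J (J x) = -x

/-- A Lie algebra is indecomposable if it is not the direct sum of two proper ideals. -/
def IsIndecomposableLie (𝔤 : Type*) [LieRing 𝔤] [LieAlgebra ℝ 𝔤] : Prop :=
  ¬ ∃ 𝔞 𝔟 : LieIdeal ℝ 𝔤, 𝔞 ≠ ⊤ ∧ 𝔟 ≠ ⊤ ∧ IsCompl 𝔞 𝔟

/-! ### The fibre: a real Lie algebra with a norm

Model fibres of vector bundles are normed spaces, so the typical fibre carries a norm besides its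
Lie bracket. The norm is not related to the bracket in any way. In finite dimension, the only case
that is used, every Lie algebra admits such a norm, and all choices are equivalent. -/

/-- A Lie ring with a norm on its additive group (no condition links norm and bracket). -/
class NormedGroupLieRing (𝔨 : Type*) extends NormedAddCommGroup 𝔨, LieRing 𝔨

/-- A real Lie algebra whose underlying vector space is a normed space (no condition links norm
and bracket). -/
class NormedSpaceLieAlgebra (𝔨 : Type*) [NormedGroupLieRing 𝔨] extends
  NormedSpace ℝ 𝔨, LieAlgebra ℝ 𝔨

/-! ### Bundles of Lie algebras and the Lie algebra of `C^k`-sections -/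

section LieBundle

variable {E : Type*} [NormedAddCommGroup E] [NormedSpace ℝ E]
  {H : Type*} [TopologicalSpace H] (I : ModelWithCorners ℝ E H)
  {M : Type*} [TopologicalSpace M] [ChartedSpace H M]
  (𝔨 : Type*) [NormedGroupLieRing 𝔨] [NormedSpaceLieAlgebra 𝔨]
  (𝕃 : M → Type*) [TopologicalSpace (TotalSpace 𝔨 𝕃)] [∀ x, TopologicalSpace (𝕃 x)]
  [∀ x, LieRing (𝕃 x)] [∀ x, LieAlgebra ℝ (𝕃 x)] [FiberBundle 𝔨 𝕃]

variable {𝔨 𝕃} in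
/-- `e` is a smooth bundle chart `π⁻¹(U) ≃ U × 𝔨` that restricts, on every fibre over `U`, to an
isomorphism of Lie algebras onto `𝔨`. -/
structure IsLieBundleChart (e : Trivialization 𝔨 (π 𝔨 𝕃)) : Prop where
  isLinear : e.IsLinear ℝ
  contMDiffOn : ContMDiffOn (I.prod 𝓘(ℝ, 𝔨)) (I.prod 𝓘(ℝ, 𝔨)) ∞ e e.source
  contMDiffOn_symm : ContMDiffOn (I.prod 𝓘(ℝ, 𝔨)) (I.prod 𝓘(ℝ, 𝔨)) ∞
    e.toOpenPartialHomeomorph.symm e.target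
  map_lie : ∀ x ∈ e.baseSet, ∀ v w : 𝕃 x, (e ⟨x, ⁅v, w⁆⟩).2 = ⁅(e ⟨x, v⟩).2, (e ⟨x, w⟩).2⁆

/-- The smooth vector bundle `𝕃` with Lie algebras as fibres is a bundle of Lie algebras with
fibre `𝔨`: it has a bundle atlas of charts that are fibrewise isomorphisms of Lie algebras onto `𝔨`
(so that its transition maps take values in `Aut(𝔨)`). -/
class IsLieAlgebraBundle : Prop where
  exists_chart : ∀ x : M, ∃ e : Trivialization 𝔨 (π 𝔨 𝕃), x ∈ e.baseSet ∧ IsLieBundleChart I e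

namespace IsLieAlgebraBundle

variable {I 𝔨 𝕃}
variable [FiniteDimensional ℝ 𝔨] [hL : IsLieAlgebraBundle I 𝔨 𝕃] {k : ℕ∞}

/-- The pointwise bracket of two `C^k`-sections is a `C^k`-section. -/
theorem contMDiff_lie (X Y : Cₛ^k⟮I; 𝔨, 𝕃⟯) :
    ContMDiff I (I.prod 𝓘(ℝ, 𝔨)) k (fun x ↦ TotalSpace.mk' 𝔨 x ⁅X x, Y x⁆) := by
  intro x
  obtain ⟨e, hx, he⟩ := hL.exists_chart x
  have hk : (k : ℕ∞ω) ≤ ∞ := mod_cast le_top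
  have key : ∀ Z : Cₛ^k⟮I; 𝔨, 𝕃⟯,
      ContMDiffAt I 𝓘(ℝ, 𝔨) k (fun y ↦ (e ⟨y, Z y⟩).2) x := by
    intro Z
    have h1 : ContMDiffAt (I.prod 𝓘(ℝ, 𝔨)) (I.prod 𝓘(ℝ, 𝔨)) k e (TotalSpace.mk' 𝔨 x (Z x)) :=
      ((he.contMDiffOn.of_le hk) _ (e.mem_source.2 hx)).contMDiffAt
        (e.open_source.mem_nhds (e.mem_source.2 hx))
    exact contMDiffAt_snd.comp x (h1.comp x (Z.contMDiff x))
  let B : 𝔨 →ₗ[ℝ] 𝔨 →ₗ[ℝ] 𝔨 := LinearMap.mk₂ ℝ (fun a b ↦ ⁅a, b⁆)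
    add_lie smul_lie lie_add (fun c a b ↦ lie_smul c a b)
  have h2 : ContMDiffAt I 𝓘(ℝ, 𝔨) k (fun y ↦ ⁅(e ⟨y, X y⟩).2, (e ⟨y, Y y⟩).2⁆) x := by
    have hB : ContDiff ℝ k (fun p : 𝔨 × 𝔨 ↦ B.toContinuousBilinearMap p.1 p.2) :=
      B.toContinuousBilinearMap.isBoundedBilinearMap.contDiff
    exact hB.contMDiff.contMDiffAt.comp x ((key X).prodMk_space (key Y))
  have hx' : (x, ⁅(e ⟨x, X x⟩).2, (e ⟨x, Y x⟩).2⁆) ∈ e.target := e.mem_target.2 hx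
  have h3 : ContMDiffAt (I.prod 𝓘(ℝ, 𝔨)) (I.prod 𝓘(ℝ, 𝔨)) k e.toOpenPartialHomeomorph.symm
      (x, ⁅(e ⟨x, X x⟩).2, (e ⟨x, Y x⟩).2⁆) :=
    ((he.contMDiffOn_symm.of_le hk) _ hx').contMDiffAt (e.open_target.mem_nhds hx')
  have h4 := h3.comp x (contMDiffAt_id.prodMk h2)
  refine h4.congr_of_eventuallyEq ?_
  filter_upwards [e.open_baseSet.mem_nhds hx] with y hy
  have h5 : (y, ⁅(e ⟨y, X y⟩).2, (e ⟨y, Y y⟩).2⁆) = e ⟨y, ⁅X y, Y y⁆⟩ := by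
    rw [← he.map_lie y hy]
    exact Prod.ext (e.coe_fst (e.mem_source (x := ⟨y, ⁅X y, Y y⁆⟩).2 hy)).symm rfl
  simp only [Function.comp_apply, id_eq, h5]
  exact (e.toOpenPartialHomeomorph.left_inv (e.mem_source.2 hy)).symm

noncomputable instance : Bracket Cₛ^k⟮I; 𝔨, 𝕃⟯ Cₛ^k⟮I; 𝔨, 𝕃⟯ where
  bracket X Y := ⟨fun x ↦ ⁅X x, Y x⁆, contMDiff_lie X Y⟩

theorem lie_apply (X Y : Cₛ^k⟮I; 𝔨, 𝕃⟯) (x : M) : ⁅X, Y⁆ x = ⁅X x, Y x⁆ := rfl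

variable [VectorBundle ℝ 𝔨 𝕃]

/-- The Lie ring `Γ^k(𝕃)` of `C^k`-sections, with the pointwise bracket. -/
noncomputable instance : LieRing Cₛ^k⟮I; 𝔨, 𝕃⟯ where
  add_lie X Y Z := by ext x; simp [lie_apply]
  lie_add X Y Z := by ext x; simp [lie_apply]
  lie_self X := by ext x; simp [lie_apply]
  leibniz_lie X Y Z := by ext x; simp [lie_apply]

/-- The real Lie algebra `Γ^k(𝕃)` of `C^k`-sections. -/
noncomputable instance : LieAlgebra ℝ Cₛ^k⟮I; 𝔨, 𝕃⟯ where
  lie_smul c X Y := by ext x; simp [lie_apply]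

end IsLieAlgebraBundle

end LieBundle

/-! ### First Čech cohomology with values in a discrete group

Smooth maps into a discrete group, viewed as a zero-dimensional Lie group, are the locally constant
maps. -/

namespace Cech

variable (M : Type*) [TopologicalSpace M] (G : Type*) [Group G]

/-- Collections of open subsets that cover `M`. -/
structure Cover where
  sets : Set (Opens M)
  covers : ∀ x : M, ∃ U ∈ sets, x ∈ U

variable {M} in
/-- `Ž¹(M, 𝔙, G)`: families `g_{VU} : U ∩ V → G` with `g_{VU} g_{UW} g_{WV} = 1` on
`U ∩ V ∩ W`. (For `U ∩ V = ∅` there is exactly one map, so nothing is added by these indices.) -/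
structure Cocycle (𝔙 : Cover M) where
  g : ∀ V U : 𝔙.sets, LocallyConstant ↥((V : Opens M) ⊓ (U : Opens M)) G
  cocycle : ∀ (U V W : 𝔙.sets) (x : M) (hU : x ∈ (U : Opens M)) (hV : x ∈ (V : Opens M))
    (hW : x ∈ (W : Opens M)),
    g V U ⟨x, hV, hU⟩ * g U W ⟨x, hU, hW⟩ * g W V ⟨x, hW, hV⟩ = 1

variable {M G}

/-- Two cocycles on the same cover are cohomologous: `k_{VU} = h_V g_{VU} h_U⁻¹` on `U ∩ V`. -/
def Cohomologous {𝔙 : Cover M} (g k : Cocycle G 𝔙) : Prop :=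
  ∃ h : ∀ U : 𝔙.sets, LocallyConstant ↥(U : Opens M) G,
    ∀ (U V : 𝔙.sets) (x : M) (hU : x ∈ (U : Opens M)) (hV : x ∈ (V : Opens M)),
      k.g V U ⟨x, hV, hU⟩ = h V ⟨x, hV⟩ * g.g V U ⟨x, hV, hU⟩ * (h U ⟨x, hU⟩)⁻¹

/-- The restriction of a cocycle along a refinement `r : 𝔚 → 𝔙`, `W ⊆ r W`. -/
def Cocycle.restrict {𝔙 𝔚 : Cover M} (g : Cocycle G 𝔙) (r : 𝔚.sets → 𝔙.sets)
    (hr : ∀ W : 𝔚.sets, (W : Opens M) ≤ (r W : Opens M)) : Cocycle G 𝔚 where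
  g V U := (g.g (r V) (r U)).comap
    ⟨Set.inclusion (inf_le_inf (hr V) (hr U) :
      (V : Opens M) ⊓ (U : Opens M) ≤ (r V : Opens M) ⊓ (r U : Opens M)),
      continuous_inclusion _⟩
  cocycle U V W x hU hV hW :=
    g.cocycle (r U) (r V) (r W) x (hr U hU) (hr V hV) (hr W hW)

/-- Cocycles on two covers become cohomologous on a common refinement, i.e. they represent the same
element of the direct limit over all covers. -/
def LimitRel (a b : Σ 𝔙 : Cover M, Cocycle G 𝔙) : Prop :=
  ∃ (𝔚 : Cover M) (r : 𝔚.sets → a.1.sets) (hr : ∀ W : 𝔚.sets, (W : Opens M) ≤ (r W : Opens M))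
    (s : 𝔚.sets → b.1.sets) (hs : ∀ W : 𝔚.sets, (W : Opens M) ≤ (s W : Opens M)),
    Cohomologous (a.2.restrict r hr) (b.2.restrict s hs)

variable (M G) in
/-- The first Čech cohomology `Ȟ¹(M, G) = colim_𝔙 Ȟ¹(M, 𝔙, G)` as a set. -/
def H1 : Type _ := Quot (LimitRel (M := M) (G := G))

end Cech

/-! ### Complex structures on real Lie algebras -/

section LieComplexStructure

variable {𝔤 𝔥 : Type*} [LieRing 𝔤] [LieAlgebra ℝ 𝔤] [LieRing 𝔥] [LieAlgebra ℝ 𝔥]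

/-! A nonzero functional on `𝔨/[𝔨,𝔨]` times a nonzero central vector would be a nonzero morphism
from the abelianization to the center, so `𝔨` is perfect or centerless. In both cases two complex
structures `J`, `J'` commute. Then `(JJ')² = 1`, the eigenspaces of `JJ'` for `1` and `-1` are
complementary ideals, and indecomposability forces `J' = ±J`.

The same dichotomy makes a complex structure on sections linear over functions
(`IsLieComplexStructure.map_funSMul`), because `J(f[A,B]) = [JA, fB] = f J[A,B]`. Finitely many
global sections span every fibre (`exists_section_span`), so a section vanishing at `x` is a finite
combination of them with coefficients vanishing at `x`. Hence `J` acts fibre by fibre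
(`IsLieComplexStructure.exists_fibrewise`). Two such structures agree up to sign on each fibre, and
connectedness makes the sign global.

Conversely, a complex structure on `𝔨` is pulled back along charts. On overlaps the results differ
by a locally constant sign, which is a Čech cocycle with values in `ℤ/2ℤ`. If that cocycle is a
coboundary, the local structures can be corrected by signs and glued
(`exists_isLieComplexStructure_section`). -/

theorem IsLieComplexStructure.neg {J : 𝔤 →ₗ[ℝ] 𝔤} (hJ : IsLieComplexStructure J) :
    IsLieComplexStructure (-J) :=
  ⟨fun x y ↦ by simp [hJ.1], fun x ↦ by simp [hJ.2]⟩

theorem IsLieComplexStructure.map_lie_left {J : 𝔤 →ₗ[ℝ] 𝔤} (hJ : IsLieComplexStructure J)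
    (x y : 𝔤) : J ⁅x, y⁆ = ⁅J x, y⁆ := by
  rw [← lie_skew, map_neg, hJ.1, lie_skew]

/-- Complex structures can be transported along an isomorphism of Lie algebras. -/
theorem IsLieComplexStructure.conj {J : 𝔤 →ₗ[ℝ] 𝔤} (hJ : IsLieComplexStructure J)
    (φ : 𝔤 ≃ₗ⁅ℝ⁆ 𝔥) : IsLieComplexStructure (φ.toLinearEquiv.conj J) := by
  have h (x : 𝔥) : φ.toLinearEquiv.conj J x = φ (J (φ.symm x)) := rfl
  refine ⟨fun x y ↦ ?_, fun x ↦ ?_⟩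
  · simp only [h, LieEquiv.map_lie, hJ.1, LieEquiv.apply_symm_apply]
  · simp only [h, LieEquiv.symm_apply_apply, hJ.2]
    simp

/-- A Lie algebra without non-zero morphisms from its abelianization to its center is perfect or
centerless. -/
theorem derived_eq_top_or_center_eq_bot
    (h : ∀ f : (𝔤 ⧸ (⁅(⊤ : LieIdeal ℝ 𝔤), (⊤ : LieIdeal ℝ 𝔤)⁆ : LieIdeal ℝ 𝔤)) →ₗ⁅ℝ⁆
      LieAlgebra.center ℝ 𝔤, f = 0) :
    (⁅(⊤ : LieIdeal ℝ 𝔤), (⊤ : LieIdeal ℝ 𝔤)⁆ : LieIdeal ℝ 𝔤) = ⊤ ∨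
      ∀ z : 𝔤, (∀ x : 𝔤, ⁅x, z⁆ = 0) → z = 0 := by
  by_contra! hcon
  obtain ⟨hD, z, hz, hz0⟩ := hcon
  set D : LieIdeal ℝ 𝔤 := ⁅(⊤ : LieIdeal ℝ 𝔤), (⊤ : LieIdeal ℝ 𝔤)⁆ with hDdef
  obtain ⟨v, hv⟩ : ∃ v : 𝔤, v ∉ D := by
    by_contra! hall
    exact hD (eq_top_iff.2 fun x _ ↦ hall x)
  have hmk (a : 𝔤) : (LieSubmodule.Quotient.mk a : 𝔤 ⧸ D) = 0 ↔ a ∈ D :=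
    Submodule.Quotient.mk_eq_zero (p := D.toSubmodule)
  obtain ⟨ℓ, hℓ⟩ := Module.Projective.exists_dual_ne_zero ℝ (mt (hmk v).1 hv)
  let ζ : LieAlgebra.center ℝ 𝔤 := ⟨z, (LieModule.mem_maxTrivSubmodule _ _ _ z).2 hz⟩
  have hquot (x y : 𝔤 ⧸ D) : ⁅x, y⁆ = 0 := by
    obtain ⟨a, rfl⟩ := Submodule.Quotient.mk_surjective _ x
    obtain ⟨b, rfl⟩ := Submodule.Quotient.mk_surjective _ y
    exact (hmk ⁅a, b⁆).2 (LieSubmodule.lie_mem_lie (LieSubmodule.mem_top a) (LieSubmodule.mem_top b))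
  -- Any linear map between abelian Lie algebras is a morphism, so the rank-one map `ℓ(·)ζ`
  -- qualifies.
  let f : (𝔤 ⧸ D) →ₗ⁅ℝ⁆ LieAlgebra.center ℝ 𝔤 :=
    { LinearMap.smulRight ℓ ζ with
      map_lie' := by
        intro x y
        have h1 : ⁅ℓ x • ζ, ℓ y • ζ⁆ = 0 := trivial_lie_zero _ _ _ _
        simp [hquot x y, h1] }
  have hf : ℓ (LieSubmodule.Quotient.mk v) • ζ = 0 := DFunLike.congr_fun (h f) _
  rcases smul_eq_zero.1 hf with h0 | h0
  · exact hℓ h0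
  · exact hz0 (congrArg Subtype.val h0)

/-- Two complex structures on an indecomposable Lie algebra that is perfect or centerless agree up
to sign. -/
theorem IsLieComplexStructure.eq_or_eq_neg (h_indec : IsIndecomposableLie 𝔤)
    (h : (⁅(⊤ : LieIdeal ℝ 𝔤), (⊤ : LieIdeal ℝ 𝔤)⁆ : LieIdeal ℝ 𝔤) = ⊤ ∨
      ∀ z : 𝔤, (∀ x : 𝔤, ⁅x, z⁆ = 0) → z = 0)
    {J J' : 𝔤 →ₗ[ℝ] 𝔤} (hJ : IsLieComplexStructure J) (hJ' : IsLieComplexStructure J') :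
    J' = J ∨ J' = -J := by
  -- Both sides equal `⁅J x, J' y⁆`: one structure goes into the left slot, the other into the
  -- right.
  have hlie (x y : 𝔤) : J (J' ⁅x, y⁆) = J' (J ⁅x, y⁆) := by
    rw [hJ'.1, hJ.map_lie_left, hJ.map_lie_left, hJ'.1]
  have hcomm : ∀ y : 𝔤, J (J' y) = J' (J y) := by
    rcases h with h | h
    · intro y
      have hy : y ∈ (⁅(⊤ : LieIdeal ℝ 𝔤), (⊤ : LieIdeal ℝ 𝔤)⁆ : LieIdeal ℝ 𝔤) := by
        rw [h]; exact LieSubmodule.mem_top y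
      rw [← LieSubmodule.mem_toSubmodule, LieSubmodule.lieIdeal_oper_eq_linear_span] at hy
      induction hy using Submodule.span_induction with
      | mem y hy =>
        obtain ⟨a, b, rfl⟩ := hy
        exact hlie _ _
      | zero => simp
      | add a b _ _ ha hb => simp [ha, hb]
      | smul c a _ ha => simp [ha]
    · intro y
      refine sub_eq_zero.1 (h _ fun x ↦ ?_)
      rw [lie_sub, ← hJ.1, ← hJ'.1, ← hJ'.1, ← hJ.1, hlie, sub_self]
  have hT2 (x : 𝔤) : J (J' (J (J' x))) = x := by
    rw [hcomm (J (J' x)), hJ.2, map_neg, hJ'.2, neg_neg]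
  -- `J ∘ J'` commutes with all `⁅x, ·⁆`, so its eigenspaces are ideals.
  let eig (ε : ℝ) : LieIdeal ℝ 𝔤 :=
    { LinearMap.ker (J ∘ₗ J' - ε • LinearMap.id) with
      lie_mem := by
        intro x m hm
        simp only [AddSubsemigroup.mem_carrier, AddSubmonoid.mem_toSubsemigroup,
          Submodule.mem_toAddSubmonoid, LinearMap.mem_ker, LinearMap.sub_apply, LinearMap.comp_apply,
          LinearMap.smul_apply, LinearMap.id_apply, sub_eq_zero] at hm ⊢
        rw [hJ'.1, hJ.1, hm, lie_smul] }
  have mem_eig (ε : ℝ) (x : 𝔤) : x ∈ eig ε ↔ J (J' x) = ε • x := by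
    change x ∈ LinearMap.ker (J ∘ₗ J' - ε • LinearMap.id) ↔ _
    simp [sub_eq_zero]
  have hcompl : IsCompl (eig 1) (eig (-1)) := by
    rw [isCompl_iff, disjoint_iff, codisjoint_iff, eq_bot_iff, eq_top_iff]
    constructor
    · intro x hx
      obtain ⟨h1, h2⟩ := (LieSubmodule.mem_inf _ _ _).1 hx
      rw [mem_eig] at h1 h2
      rw [LieSubmodule.mem_bot]
      rw [h1, one_smul, neg_smul, one_smul] at h2
      rw [eq_neg_iff_add_eq_zero, ← two_smul ℝ, smul_eq_zero] at h2
      exact h2.resolve_left two_ne_zero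
    · intro x _
      rw [LieSubmodule.mem_sup]
      refine ⟨(1 / 2 : ℝ) • (x + J (J' x)), ?_, (1 / 2 : ℝ) • (x - J (J' x)), ?_, ?_⟩
      · rw [mem_eig]
        simp only [map_smul, map_add, hT2, one_smul, add_comm]
      · rw [mem_eig]
        simp only [map_smul, map_sub, hT2]
        module
      · module
  have hor : eig 1 = ⊤ ∨ eig (-1) = ⊤ := by
    by_contra! hne
    exact h_indec ⟨_, _, hne.1, hne.2, hcompl⟩
  have hneg (x : 𝔤) : J' x = -J (J (J' x)) := by rw [hJ.2, neg_neg]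
  rcases hor with h1 | h1
  · refine Or.inr (LinearMap.ext fun x ↦ ?_)
    have : J (J' x) = (1 : ℝ) • x := (mem_eig 1 x).1 (by rw [h1]; exact LieSubmodule.mem_top x)
    rw [hneg, this, one_smul, LinearMap.neg_apply]
  · refine Or.inl (LinearMap.ext fun x ↦ ?_)
    have : J (J' x) = (-1 : ℝ) • x := (mem_eig (-1) x).1 (by rw [h1]; exact LieSubmodule.mem_top x)
    rw [hneg, this, neg_smul, one_smul, map_neg, neg_neg]

end LieComplexStructure

/-! ### Connected paracompact spaces -/

/-- A connected, paracompact, locally compact Hausdorff space is σ-compact. -/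
theorem sigmaCompactSpace_of_connectedSpace (X : Type*) [TopologicalSpace X] [T2Space X]
    [WeaklyLocallyCompactSpace X] [ParacompactSpace X] [ConnectedSpace X] :
    SigmaCompactSpace X := by
  choose K hK hKx using fun x : X ↦ exists_compact_mem_nhds x
  obtain ⟨v, hvo, hvc, hvf, hvK⟩ := precise_refinement (fun x ↦ interior (K x))
    (fun _ ↦ isOpen_interior)
    (Set.iUnion_eq_univ_iff.2 fun x ↦ ⟨x, mem_interior_iff_mem_nhds.2 (hKx x)⟩)
  have hvcpt (x : X) : IsCompact (closure (v x)) :=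
    (hK x).closure_of_subset ((hvK x).trans interior_subset)
  -- Only finitely many `v i` meet a compact `C`, so the union of their closures is a compact
  -- neighbourhood of `C`. Iterating from a point gives a union that is open.
  have step (C : Set X) (hC : IsCompact C) : ∃ C', IsCompact C' ∧ C ⊆ interior C' ∧
      ∀ i, (v i ∩ C).Nonempty → v i ⊆ C' := by
    have hfin := hvf.finite_nonempty_inter_compact hC
    refine ⟨⋃ i ∈ {i | (v i ∩ C).Nonempty}, closure (v i), hfin.isCompact_biUnion fun i _ ↦ hvcpt i,
      fun x hx ↦ ?_, fun i hi ↦ ?_⟩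
    · obtain ⟨i, hi⟩ := Set.iUnion_eq_univ_iff.1 hvc x
      exact mem_interior.2 ⟨v i, fun y hy ↦ Set.mem_biUnion (show (v i ∩ C).Nonempty from ⟨x, hi, hx⟩)
        (subset_closure hy), hvo i, hi⟩
    · exact fun y hy ↦ Set.mem_biUnion hi (subset_closure hy)
  choose! next hnc hni hnv using step
  obtain ⟨x₀⟩ := (inferInstance : Nonempty X)
  let C (n : ℕ) : Set X := next^[n] {x₀}
  have hCs (n : ℕ) : C (n + 1) = next (C n) := Function.iterate_succ_apply' _ _ _
  have hC (n : ℕ) : IsCompact (C n) := by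
    induction n with
    | zero => exact isCompact_singleton
    | succ n ih => rw [hCs]; exact hnc _ ih
  have hopen : IsOpen (⋃ n, C n) := by
    rw [isOpen_iff_mem_nhds]
    intro x hx
    obtain ⟨n, hn⟩ := Set.mem_iUnion.1 hx
    refine Filter.mem_of_superset (mem_interior_iff_mem_nhds.1 (hni _ (hC n) hn)) ?_
    rw [← hCs]
    exact Set.subset_iUnion _ _
  -- If a set `v i` around `x` meets some `C n`, then `v i ⊆ C (n + 1)`; so no point outside the
  -- union is a limit of it.
  have hclosed : IsClosed (⋃ n, C n) := by
    rw [← isOpen_compl_iff, isOpen_iff_mem_nhds]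
    intro x hx
    obtain ⟨i, hi⟩ := Set.iUnion_eq_univ_iff.1 hvc x
    refine Filter.mem_of_superset ((hvo i).mem_nhds hi) fun y hy hyC ↦ hx ?_
    obtain ⟨n, hn⟩ := Set.mem_iUnion.1 hyC
    refine Set.mem_iUnion.2 ⟨n + 1, ?_⟩
    rw [hCs]
    exact hnv _ (hC n) i ⟨y, hy, hn⟩ hi
  have huniv : ⋃ n, C n = Set.univ :=
    IsClopen.eq_univ ⟨hclosed, hopen⟩ ⟨x₀, Set.mem_iUnion.2 ⟨0, rfl⟩⟩
  exact SigmaCompactSpace_iff_exists_compact_covering.2 ⟨C, hC, huniv⟩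

/-! ### Charts of bundles of Lie algebras -/

namespace IsLieBundleChart

variable {E : Type*} [NormedAddCommGroup E] [NormedSpace ℝ E]
  {H : Type*} [TopologicalSpace H] {I : ModelWithCorners ℝ E H}
  {M : Type*} [TopologicalSpace M] [ChartedSpace H M]
  {𝔨 : Type*} [NormedGroupLieRing 𝔨] [NormedSpaceLieAlgebra 𝔨]
  {𝕃 : M → Type*} [TopologicalSpace (TotalSpace 𝔨 𝕃)] [∀ x, TopologicalSpace (𝕃 x)]
  [∀ x, LieRing (𝕃 x)] [∀ x, LieAlgebra ℝ (𝕃 x)] [FiberBundle 𝔨 𝕃]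
  {e : Trivialization 𝔨 (π 𝔨 𝕃)} {x : M}

/-- The isomorphism of Lie algebras between a fibre and the typical fibre given by a chart. -/
noncomputable def lieEquivAt (he : IsLieBundleChart I e) (hx : x ∈ e.baseSet) : 𝕃 x ≃ₗ⁅ℝ⁆ 𝔨 :=
  haveI := he.isLinear
  { e.linearEquivAt ℝ x hx with
    map_lie' := fun {v w} ↦ he.map_lie x hx v w }

/-- A section is `C^n` at a point iff its local representation in a chart is. -/
theorem contMDiffAt_section_iff (he : IsLieBundleChart I e) (hx : x ∈ e.baseSet) {n : ℕ∞}
    {s : ∀ y, 𝕃 y} :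
    ContMDiffAt I (I.prod 𝓘(ℝ, 𝔨)) n (fun y ↦ TotalSpace.mk' 𝔨 y (s y)) x ↔
      ContMDiffAt I 𝓘(ℝ, 𝔨) n (fun y ↦ (e ⟨y, s y⟩).2) x := by
  have hn : (n : ℕ∞ω) ≤ ∞ := mod_cast le_top
  constructor
  · intro hs
    have h1 : ContMDiffAt (I.prod 𝓘(ℝ, 𝔨)) (I.prod 𝓘(ℝ, 𝔨)) n e (TotalSpace.mk' 𝔨 x (s x)) :=
      ((he.contMDiffOn.of_le hn) _ (e.mem_source.2 hx)).contMDiffAt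
        (e.open_source.mem_nhds (e.mem_source.2 hx))
    exact contMDiffAt_snd.comp x (h1.comp x hs)
  · intro hs
    have hx' : (x, (e ⟨x, s x⟩).2) ∈ e.target := e.mem_target.2 hx
    have h3 : ContMDiffAt (I.prod 𝓘(ℝ, 𝔨)) (I.prod 𝓘(ℝ, 𝔨)) n e.toOpenPartialHomeomorph.symm
        (x, (e ⟨x, s x⟩).2) :=
      ((he.contMDiffOn_symm.of_le hn) _ hx').contMDiffAt (e.open_target.mem_nhds hx')
    refine (h3.comp x (contMDiffAt_id.prodMk hs)).congr_of_eventuallyEq ?_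
    filter_upwards [e.open_baseSet.mem_nhds hx] with y hy
    have h5 : (y, (e ⟨y, s y⟩).2) = e ⟨y, s y⟩ :=
      Prod.ext (e.coe_fst (e.mem_source (x := ⟨y, s y⟩).2 hy)).symm rfl
    simp only [Function.comp_apply, id_eq, h5]
    exact (e.toOpenPartialHomeomorph.left_inv (e.mem_source.2 hy)).symm

/-- The local section with constant local representation. -/
theorem contMDiffOn_symm_const (he : IsLieBundleChart I e) {n : ℕ∞} (v : 𝔨) :
    ContMDiffOn I (I.prod 𝓘(ℝ, 𝔨)) n (fun y ↦ TotalSpace.mk' 𝔨 y (e.symm y v)) e.baseSet := by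
  intro x hx
  refine ContMDiffAt.contMDiffWithinAt ((he.contMDiffAt_section_iff hx).2 ?_)
  refine (contMDiffAt_const (c := v)).congr_of_eventuallyEq ?_
  filter_upwards [e.open_baseSet.mem_nhds hx] with y hy
  exact (he.lieEquivAt hy).apply_symm_apply v

end IsLieBundleChart

/-! ### Sections -/

section Sections

variable {E : Type*} [NormedAddCommGroup E] [NormedSpace ℝ E]
  {H : Type*} [TopologicalSpace H] {I : ModelWithCorners ℝ E H}
  {M : Type*} [TopologicalSpace M] [ChartedSpace H M]
  {𝔨 : Type*} [NormedGroupLieRing 𝔨] [NormedSpaceLieAlgebra 𝔨]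
  {𝕃 : M → Type*} [TopologicalSpace (TotalSpace 𝔨 𝕃)] [∀ x, TopologicalSpace (𝕃 x)]
  [∀ x, LieRing (𝕃 x)] [∀ x, LieAlgebra ℝ (𝕃 x)] [FiberBundle 𝔨 𝕃] [VectorBundle ℝ 𝔨 𝕃]
  {k : ℕ∞}

namespace ContMDiffSection

/-- Multiplication of a `C^k`-section by a `C^k`-function. -/
noncomputable def funSMul (f : C^k⟮I, M; 𝓘(ℝ, ℝ), ℝ⟯) (X : Cₛ^k⟮I; 𝔨, 𝕃⟯) : Cₛ^k⟮I; 𝔨, 𝕃⟯ :=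
  ⟨fun x ↦ f x • X x, f.contMDiff.smul_section X.contMDiff⟩

theorem funSMul_apply (f : C^k⟮I, M; 𝓘(ℝ, ℝ), ℝ⟯) (X : Cₛ^k⟮I; 𝔨, 𝕃⟯) (x : M) :
    funSMul f X x = f x • X x := rfl

variable (I 𝔨 𝕃 k) in
/-- Evaluation of `C^k`-sections at a point. -/
noncomputable def evalₗ (x : M) : Cₛ^k⟮I; 𝔨, 𝕃⟯ →ₗ[ℝ] 𝕃 x where
  toFun X := X x
  map_add' _ _ := rfl
  map_smul' _ _ := rfl

theorem sum_apply {ι : Type*} (s : Finset ι) (X : ι → Cₛ^k⟮I; 𝔨, 𝕃⟯) (x : M) :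
    (∑ i ∈ s, X i) x = ∑ i ∈ s, X i x :=
  map_sum (evalₗ I 𝔨 𝕃 k x) X s

/-- Smooth sections are `C^k`. -/
noncomputable def ofSmooth (k : ℕ∞) (X : Cₛ^∞⟮I; 𝔨, 𝕃⟯) : Cₛ^k⟮I; 𝔨, 𝕃⟯ :=
  ⟨X, X.contMDiff.of_le (mod_cast le_top)⟩

section Lie

variable [FiniteDimensional ℝ 𝔨] [IsLieAlgebraBundle I 𝔨 𝕃]

theorem lie_funSMul (f : C^k⟮I, M; 𝓘(ℝ, ℝ), ℝ⟯) (X Y : Cₛ^k⟮I; 𝔨, 𝕃⟯) :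
    ⁅X, funSMul f Y⁆ = funSMul f ⁅X, Y⁆ := by
  ext x
  simp [IsLieAlgebraBundle.lie_apply, funSMul_apply]

end Lie

variable [hL : IsLieAlgebraBundle I 𝔨 𝕃] [FiniteDimensional ℝ E] [IsManifold I ∞ M] [T2Space M] [SigmaCompactSpace M]

/-- Every vector of a fibre is the value of a `C^k`-section. -/
theorem exists_apply_eq (x : M) (v : 𝕃 x) : ∃ X : Cₛ^k⟮I; 𝔨, 𝕃⟯, X x = v := by
  classical
  -- The convex condition to be glued is vacuous except over `x`, where it prescribes the value `v`.
  obtain ⟨X, hX⟩ := exists_contMDiffSection_forall_mem_convex_of_local (n := k) (F_fiber := 𝔨) I 𝕃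
    (fun y ↦ {w | ∀ h : x = y, w = h ▸ v})
    (fun y w hw w' hw' a b _ _ hab h ↦ by
      rw [hw h, hw' h, ← add_smul, hab, one_smul])
    (fun y ↦ by
      by_cases h : x = y
      · subst h
        obtain ⟨e, hx, he⟩ := hL.exists_chart x
        refine ⟨e.baseSet, e.open_baseSet.mem_nhds hx, fun y ↦ e.symm y (e ⟨x, v⟩).2,
          he.contMDiffOn_symm_const _, fun y _ h ↦ ?_⟩
        subst h
        exact (he.lieEquivAt hx).symm_apply_apply v
      · refine ⟨{x}ᶜ, isOpen_compl_singleton.mem_nhds (Ne.symm h), fun _ ↦ 0,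
          (0 : Cₛ^k⟮I; 𝔨, 𝕃⟯).contMDiff.contMDiffOn, fun z hz h ↦ ?_⟩
        exact absurd h.symm hz)
  exact ⟨X, hX x rfl⟩

end ContMDiffSection

end Sections

/-! ### Finitely many sections that span all fibres -/

section Spanning

open Module ContMDiffSection

variable {E : Type*} [NormedAddCommGroup E] [NormedSpace ℝ E] [FiniteDimensional ℝ E]
  {M : Type*} [TopologicalSpace M] [ChartedSpace E M] [IsManifold 𝓘(ℝ, E) ∞ M]
  [T2Space M] [SigmaCompactSpace M]
  {𝔨 : Type*} [NormedGroupLieRing 𝔨] [NormedSpaceLieAlgebra 𝔨] [FiniteDimensional ℝ 𝔨]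
  {𝕃 : M → Type*} [TopologicalSpace (TotalSpace 𝔨 𝕃)] [∀ x, TopologicalSpace (𝕃 x)]
  [∀ x, LieRing (𝕃 x)] [∀ x, LieAlgebra ℝ (𝕃 x)] [FiberBundle 𝔨 𝕃] [VectorBundle ℝ 𝔨 𝕃]
  [hL : IsLieAlgebraBundle 𝓘(ℝ, E) 𝔨 𝕃]

omit hL [FiniteDimensional ℝ E] [IsManifold 𝓘(ℝ, E) ∞ M] [T2Space M] [SigmaCompactSpace M]
  [FiniteDimensional ℝ 𝔨] [VectorBundle ℝ 𝔨 𝕃] in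
theorem IsLieBundleChart.span_range_eq_top_iff {e : Trivialization 𝔨 (π 𝔨 𝕃)}
    (he : IsLieBundleChart 𝓘(ℝ, E) e) {x : M} (hx : x ∈ e.baseSet) {ι : Type*} (v : ι → 𝕃 x) :
    Submodule.span ℝ (Set.range v) = ⊤ ↔
      Submodule.span ℝ (Set.range fun i ↦ (e ⟨x, v i⟩).2) = ⊤ := by
  have h : (Set.range fun i ↦ (e ⟨x, v i⟩).2) =
      (he.lieEquivAt hx).toLinearEquiv.toLinearMap '' Set.range v := by
    rw [← Set.range_comp]; rfl
  rw [h, Submodule.span_image, Submodule.map_eq_top_iff]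

/-- Sections that span a fibre exist, and still span the nearby fibres. -/
theorem exists_finset_section_span_nhds (x : M) :
    ∃ F : Set Cₛ^∞⟮𝓘(ℝ, E); 𝔨, 𝕃⟯, F.Finite ∧
      ∀ᶠ y in nhds x, Submodule.span ℝ ((fun X : Cₛ^∞⟮𝓘(ℝ, E); 𝔨, 𝕃⟯ ↦ X y) '' F) = ⊤ := by
  obtain ⟨e, hx, he⟩ := hL.exists_chart x
  let b := finBasis ℝ 𝔨
  choose S hS using fun i ↦ exists_apply_eq (I := 𝓘(ℝ, E)) (𝔨 := 𝔨) (𝕃 := 𝕃) (k := ⊤) x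
    ((he.lieEquivAt hx).symm (b i))
  let w (y : M) (i : Fin (finrank ℝ 𝔨)) : 𝔨 := (e ⟨y, S i y⟩).2
  have hw : ContinuousAt w x := continuousAt_pi.2 fun i ↦
    ((he.contMDiffAt_section_iff hx).1 ((S i).contMDiff x)).continuousAt
  have hwx : w x = b := by
    funext i
    change he.lieEquivAt hx (S i x) = b i
    rw [hS, LieEquiv.apply_symm_apply]
  have hli : ∀ᶠ y in nhds x, LinearIndependent ℝ (w y) := by
    refine hw.eventually (isOpen_setOfPred_linearIndependent.mem_nhds ?_)
    rw [hwx]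
    exact b.linearIndependent
  refine ⟨Set.range S, Set.finite_range S, ?_⟩
  filter_upwards [hli, e.open_baseSet.mem_nhds hx] with y hy hye
  rw [← Set.range_comp]
  refine (he.span_range_eq_top_iff hye _).2 ?_
  exact hy.span_eq_top_of_card_eq_finrank' (by simp)

theorem exists_section_span_of_isCompact {K : Set M} (hK : IsCompact K) :
    ∃ (N : ℕ) (S : Fin N → Cₛ^∞⟮𝓘(ℝ, E); 𝔨, 𝕃⟯),
      ∀ x ∈ K, Submodule.span ℝ (Set.range fun i ↦ S i x) = ⊤ := by
  have h : ∃ F : Set Cₛ^∞⟮𝓘(ℝ, E); 𝔨, 𝕃⟯, F.Finite ∧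
      ∀ x ∈ K, Submodule.span ℝ ((fun X : Cₛ^∞⟮𝓘(ℝ, E); 𝔨, 𝕃⟯ ↦ X x) '' F) = ⊤ := by
    refine hK.induction_on ⟨∅, Set.finite_empty, by simp⟩ ?_ ?_ ?_
    · rintro s t hst ⟨F, hF, h⟩
      exact ⟨F, hF, fun x hx ↦ h x (hst hx)⟩
    · rintro s t ⟨F, hF, h⟩ ⟨F', hF', h'⟩
      refine ⟨F ∪ F', hF.union hF', fun x hx ↦ top_le_iff.1 ?_⟩
      rcases hx with hx | hx
      · rw [← h x hx]
        exact Submodule.span_mono (Set.image_mono Set.subset_union_left)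
      · rw [← h' x hx]
        exact Submodule.span_mono (Set.image_mono Set.subset_union_right)
    · intro x _
      obtain ⟨F, hF, h⟩ := exists_finset_section_span_nhds (E := E) (𝔨 := 𝔨) (𝕃 := 𝕃) x
      exact ⟨_, mem_nhdsWithin_of_mem_nhds h, F, hF, fun y hy ↦ hy⟩
  obtain ⟨F, hF, h⟩ := h
  obtain ⟨N, S, -, rfl⟩ := hF.fin_param
  refine ⟨N, S, fun x hx ↦ ?_⟩
  rw [← h x hx, ← Set.range_comp]
  rfl

omit [T2Space M] [VectorBundle ℝ 𝔨 𝕃] in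
/-- Generic linear functionals on a large space of sections do not come from a fibre. -/
theorem exists_forall_dual_comp_ne {N : ℕ} (S : Fin N → Cₛ^∞⟮𝓘(ℝ, E); 𝔨, 𝕃⟯)
    (hN : finrank ℝ E + finrank ℝ 𝔨 < N) :
    ∃ c : Fin N → ℝ, ∀ (x : M) (ξ : 𝕃 x →ₗ[ℝ] ℝ), (fun i ↦ ξ (S i x)) ≠ c := by
  have local_bound (x₀ : M) : ∃ U ∈ nhds x₀,
      dimH {c : Fin N → ℝ | ∃ x ∈ U, ∃ ξ : 𝕃 x →ₗ[ℝ] ℝ, (fun i ↦ ξ (S i x)) = c} ≤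
        (finrank ℝ E + finrank ℝ 𝔨 : ℕ) := by
    obtain ⟨e, hx, he⟩ := hL.exists_chart x₀
    let φ := extChartAt 𝓘(ℝ, E) x₀
    let g (i : Fin N) (z : E) : 𝔨 := (e ⟨φ.symm z, S i (φ.symm z)⟩).2
    have hopen : φ.target ∩ φ.symm ⁻¹' e.baseSet ∈ nhds (φ x₀) :=
      Filter.inter_mem (extChartAt_target_mem_nhds x₀)
        ((continuousAt_extChartAt_symm x₀).preimage_mem_nhds
          (by rw [extChartAt_to_inv]; exact e.open_baseSet.mem_nhds hx))
    obtain ⟨r, hr, hball⟩ := Metric.mem_nhds_iff.1 hopen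
    have hg (i : Fin N) : ContDiffOn ℝ 1 (g i) (Metric.ball (φ x₀) r) := by
      rw [← contMDiffOn_iff_contDiffOn]
      intro z hz
      have h1 : ContMDiffAt 𝓘(ℝ, E) 𝓘(ℝ, 𝔨) 1 (fun y ↦ (e ⟨y, S i y⟩).2) (φ.symm z) :=
        ((he.contMDiffAt_section_iff (n := ⊤) (hball hz).2).1 ((S i).contMDiff _)).of_le
          (mod_cast le_top)
      have h2 : ContMDiffAt 𝓘(ℝ, E) 𝓘(ℝ, E) 1 φ.symm z :=
        ((contMDiffOn_extChartAt_symm (n := ∞) x₀).contMDiffAt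
          ((isOpen_extChartAt_target x₀).mem_nhds (hball hz).1)).of_le (mod_cast le_top)
      exact (h1.comp z h2).contMDiffWithinAt
    -- Near `x₀` all bad vectors `c` lie in the image of this `C¹` map, whose domain has dimension
    -- `dim M + dim 𝔨`. Such maps do not raise Hausdorff dimension, and countably many
    -- neighbourhoods cover `M`.
    let F (p : E × (𝔨 →L[ℝ] ℝ)) (i : Fin N) : ℝ := p.2 (g i p.1)
    have hF : ContDiffOn ℝ 1 F (Metric.ball (φ x₀) r ×ˢ Set.univ) :=
      contDiffOn_pi.2 fun i ↦ contDiffOn_snd.clm_apply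
        ((hg i).comp contDiffOn_fst fun p hp ↦ hp.1)
    refine ⟨φ.source ∩ φ ⁻¹' Metric.ball (φ x₀) r, Filter.inter_mem (extChartAt_source_mem_nhds x₀)
      ((continuousAt_extChartAt x₀).preimage_mem_nhds (Metric.ball_mem_nhds _ hr)), ?_⟩
    calc dimH _ ≤ dimH (F '' (Metric.ball (φ x₀) r ×ˢ Set.univ)) := by
          refine dimH_mono ?_
          rintro c ⟨x, ⟨hxs, hxb⟩, ξ, rfl⟩
          have hxe : x ∈ e.baseSet := by
            have := (hball hxb).2
            rwa [Set.mem_preimage, φ.left_inv hxs] at this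
          refine ⟨(φ x, (ξ ∘ₗ (he.lieEquivAt hxe).symm.toLinearEquiv.toLinearMap).toContinuousLinearMap),
            ⟨hxb, trivial⟩, funext fun i ↦ ?_⟩
          change ξ ((he.lieEquivAt hxe).symm (e ⟨φ.symm (φ x), S i (φ.symm (φ x))⟩).2) = _
          rw [φ.left_inv hxs]
          exact congrArg ξ ((he.lieEquivAt hxe).symm_apply_apply _)
      _ ≤ dimH (Metric.ball (φ x₀) r ×ˢ (Set.univ : Set (𝔨 →L[ℝ] ℝ))) :=
          hF.dimH_image_le ((convex_ball _ _).prod convex_univ) subset_rfl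
      _ ≤ dimH (Set.univ : Set (E × (𝔨 →L[ℝ] ℝ))) := dimH_mono (Set.subset_univ _)
      _ = (finrank ℝ E + finrank ℝ 𝔨 : ℕ) := by
          rw [Real.dimH_univ_eq_finrank, finrank_prod,
            ← (LinearMap.toContinuousLinearMap (𝕜 := ℝ) (E := 𝔨) (F' := ℝ)).finrank_eq,
            Subspace.dual_finrank_eq]
  choose U hU hdim using local_bound
  obtain ⟨s, hs, hsU⟩ := countable_cover_nhds_of_sigmaCompact hU
  have hbad : dimH (⋃ x₀ ∈ s,
      {c : Fin N → ℝ | ∃ x ∈ U x₀, ∃ ξ : 𝕃 x →ₗ[ℝ] ℝ, (fun i ↦ ξ (S i x)) = c}) <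
        finrank ℝ (Fin N → ℝ) := by
    rw [dimH_bUnion hs]
    refine (iSup₂_le fun x₀ _ ↦ hdim x₀).trans_lt ?_
    simpa using mod_cast hN
  obtain ⟨c, hc⟩ := (dense_compl_of_dimH_lt_finrank hbad).nonempty
  refine ⟨c, fun x ξ hξ ↦ hc ?_⟩
  obtain ⟨x₀, hx₀, hx⟩ := Set.mem_iUnion₂.1 (hsU ▸ Set.mem_univ x : x ∈ ⋃ x ∈ s, U x)
  exact Set.mem_iUnion₂.2 ⟨x₀, hx₀, x, hx, ξ, hξ⟩

omit [T2Space M] in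
/-- A spanning family of more than `dim M + dim 𝔨` sections can be made smaller. -/
theorem exists_section_span_pred [Nonempty M] {N : ℕ} (S : Fin (N + 1) → Cₛ^∞⟮𝓘(ℝ, E); 𝔨, 𝕃⟯)
    (hN : finrank ℝ E + finrank ℝ 𝔨 < N + 1) :
    ∃ S' : Fin N → Cₛ^∞⟮𝓘(ℝ, E); 𝔨, 𝕃⟯, ∀ x : M,
      Submodule.span ℝ (Set.range fun i ↦ S i x) = ⊤ →
        Submodule.span ℝ (Set.range fun i ↦ S' i x) = ⊤ := by
  obtain ⟨c, hc⟩ := exists_forall_dual_comp_ne S hN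
  -- The functional `ξ = 0` realizes the zero vector, so `c` is not zero.
  obtain ⟨j, hj⟩ : ∃ j, c j ≠ 0 := by
    by_contra! h
    obtain ⟨x⟩ := (inferInstance : Nonempty M)
    exact hc x 0 (funext fun i ↦ (h i).symm)
  -- This projects along `c`. A functional on the fibre killing all new sections has values `ξ(S i
  -- x)` proportional to `c`. Either they all vanish, so `ξ = 0` where the old sections span, or a
  -- multiple of `ξ` realizes `c`.
  refine ⟨fun i ↦ S (j.succAbove i) - (c (j.succAbove i) / c j) • S j, fun x hx ↦ ?_⟩
  by_contra hne
  obtain ⟨ξ, hξ0, hξ⟩ := Submodule.exists_dual_map_eq_bot_of_lt_top (lt_top_iff_ne_top.2 hne)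
    inferInstance
  have hker (i : Fin N) : ξ (S (j.succAbove i) x) = c (j.succAbove i) / c j * ξ (S j x) := by
    have h1 : ξ ((S (j.succAbove i) - (c (j.succAbove i) / c j) • S j) x) = 0 := by
      have := Submodule.mem_map_of_mem (f := ξ)
        (Submodule.subset_span (Set.mem_range_self (f := fun i ↦
          (S (j.succAbove i) - (c (j.succAbove i) / c j) • S j) x) i))
      rwa [hξ, Submodule.mem_bot] at this
    simpa [sub_eq_zero] using h1
  have hall (i : Fin (N + 1)) : ξ (S i x) = c i / c j * ξ (S j x) := by
    rcases Fin.eq_self_or_eq_succAbove j i with rfl | ⟨i, rfl⟩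
    · rw [div_self hj, one_mul]
    · exact hker i
  by_cases h0 : ξ (S j x) = 0
  · refine hξ0 (LinearMap.ext_on_range (v := fun i ↦ S i x) hx fun i ↦ ?_)
    rw [hall, h0, mul_zero, LinearMap.zero_apply]
  · refine hc x ((c j / ξ (S j x)) • ξ) (funext fun i ↦ ?_)
    rw [LinearMap.smul_apply, hall i, smul_eq_mul]
    field_simp

omit [T2Space M] in
-- The number of sections no longer depends on the region where the given family spans. This uniform
-- bound is what allows the annuli of an exhaustion of `M` to be treated simultaneously.
theorem exists_section_span_card [Nonempty M] (N : ℕ) (S : Fin N → Cₛ^∞⟮𝓘(ℝ, E); 𝔨, 𝕃⟯) :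
    ∃ S' : Fin (finrank ℝ E + finrank ℝ 𝔨) → Cₛ^∞⟮𝓘(ℝ, E); 𝔨, 𝕃⟯, ∀ x : M,
      Submodule.span ℝ (Set.range fun i ↦ S i x) = ⊤ →
        Submodule.span ℝ (Set.range fun i ↦ S' i x) = ⊤ := by
  by_cases hN : N ≤ finrank ℝ E + finrank ℝ 𝔨
  · refine ⟨fun i ↦ if h : i.1 < N then S ⟨i, h⟩ else 0, fun x hx ↦ top_le_iff.1 ?_⟩
    rw [← hx]
    refine Submodule.span_mono ?_
    rintro _ ⟨i, rfl⟩
    exact ⟨⟨i, i.2.trans_le hN⟩, by simp⟩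
  · induction N with
    | zero => exact absurd (Nat.zero_le _) hN
    | succ N ih =>
      obtain ⟨S', hS'⟩ := exists_section_span_pred S (not_le.1 hN)
      by_cases hN' : N = finrank ℝ E + finrank ℝ 𝔨
      · subst hN'
        exact ⟨S', hS'⟩
      · obtain ⟨S'', hS''⟩ := ih S' (by omega)
        exact ⟨S'', fun x hx ↦ hS'' x (hS' x hx)⟩

variable (E 𝔨 𝕃) in
/-- There are finitely many smooth sections that span every fibre. -/
theorem exists_section_span [Nonempty M] :
    ∃ (N : ℕ) (S : Fin N → Cₛ^∞⟮𝓘(ℝ, E); 𝔨, 𝕃⟯),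
      ∀ x, Submodule.span ℝ (Set.range fun i ↦ S i x) = ⊤ := by
  have : LocallyCompactSpace M := ChartedSpace.locallyCompactSpace E M
  -- The shift makes `K 0` empty, so the open annuli `V m` cover `M`. Annuli with distinct indices
  -- of the same parity are disjoint, so one family of sections for each parity suffices.
  let K := (CompactExhaustion.choice M).shiftr
  let V (m : ℕ) : Set M := interior (K (m + 2)) \ K m
  have hVopen (m : ℕ) : IsOpen (V m) := isOpen_interior.sdiff (K.isCompact m).isClosed
  choose χ hχsupp hχ _ using fun m ↦ (hVopen m).exists_contMDiff_support_eq (n := ⊤) 𝓘(ℝ, E)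
  choose N S hS using fun m ↦ exists_section_span_of_isCompact (E := E) (𝔨 := 𝔨) (𝕃 := 𝕃)
    (K.isCompact (m + 2))
  choose S' hS' using fun m ↦ exists_section_span_card (N m) (S m)
  have hdisj {m m' : ℕ} {x : M} (h : x ∈ V m) (h' : x ∈ V m') : m' < m + 2 := by
    by_contra! hlt
    exact h'.2 (K.subset hlt (interior_subset h.1))
  have hfin : LocallyFinite V := fun x ↦ by
    obtain ⟨n, hn⟩ := K.exists_mem_nhds x
    refine ⟨_, hn, (Set.finite_lt_nat n).subset ?_⟩
    rintro m ⟨y, hyV, hyK⟩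
    exact not_le.1 fun hle ↦ hyV.2 (K.subset hle hyK)
  let T (p : Fin 2) (i : Fin (finrank ℝ E + finrank ℝ 𝔨)) : Cₛ^∞⟮𝓘(ℝ, E); 𝔨, 𝕃⟯ :=
    ⟨fun x ↦ ∑ᶠ q : ℕ, χ (2 * q + p) x • S' (2 * q + p) i x, by
      refine ContMDiff.finsum_section_of_locallyFinite ?_ fun q ↦
        (hχ (2 * q + p)).smul_section (S' (2 * q + p) i).contMDiff
      refine (hfin.comp_injective (g := fun q ↦ 2 * q + (p : ℕ)) fun a b h ↦ by
        simpa using h).subset fun q x hx ↦ ?_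
      rw [Function.comp_apply, ← hχsupp]
      exact left_ne_zero_of_smul hx⟩
  have hT (q : ℕ) (p : Fin 2) (i) (x : M) (hx : x ∈ V (2 * q + p)) :
      T p i x = χ (2 * q + p) x • S' (2 * q + p) i x := by
    refine finsum_eq_single (fun q : ℕ ↦ χ (2 * q + p) x • S' (2 * q + p) i x) q fun q' hq' ↦ ?_
    have : x ∉ V (2 * q' + p) := fun h ↦ hq' (by
      have h1 := hdisj h hx
      have h2 := hdisj hx h
      omega)
    rw [← hχsupp, Function.notMem_support] at this
    rw [this, zero_smul]
  let ε : Fin 2 × Fin (finrank ℝ E + finrank ℝ 𝔨) ≃ Fin _ := Fintype.equivFin _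
  refine ⟨_, fun a ↦ T (ε.symm a).1 (ε.symm a).2, fun x ↦ top_le_iff.1 ?_⟩
  obtain ⟨m, hm⟩ : ∃ m, x ∈ V m := by
    have hx := (CompactExhaustion.choice M).mem_sdiff_shiftr_find x
    exact ⟨_, K.subset_interior_succ _ hx.1, hx.2⟩
  obtain ⟨q, p, rfl⟩ : ∃ (q : ℕ) (p : Fin 2), m = 2 * q + p :=
    ⟨m / 2, ⟨m % 2, Nat.mod_lt _ two_pos⟩, (Nat.div_add_mod m 2).symm⟩
  rw [← hS' _ x (hS _ x (interior_subset hm.1)), Submodule.span_le]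
  rintro _ ⟨i, rfl⟩
  have hne : χ (2 * q + p) x ≠ 0 := by
    rw [← Function.mem_support, hχsupp]; exact hm
  have hi : S' (2 * q + p) i x = (χ (2 * q + p) x)⁻¹ • T p i x := by
    rw [hT q p i x hm, smul_smul, inv_mul_cancel₀ hne, one_smul]
  change S' (2 * q + p) i x ∈ _
  rw [hi]
  exact Submodule.smul_mem _ _ (Submodule.subset_span ⟨ε (p, i), by simp⟩)

end Spanning

/-! ### Complex structures on the Lie algebra of sections are fibrewise -/

section Fibrewise

open ContMDiffSection

variable {E : Type*} [NormedAddCommGroup E] [NormedSpace ℝ E] [FiniteDimensional ℝ E]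
  {M : Type*} [TopologicalSpace M] [ChartedSpace E M] [IsManifold 𝓘(ℝ, E) ∞ M]
  [T2Space M] [SigmaCompactSpace M]
  {𝔨 : Type*} [NormedGroupLieRing 𝔨] [NormedSpaceLieAlgebra 𝔨] [FiniteDimensional ℝ 𝔨]
  {𝕃 : M → Type*} [TopologicalSpace (TotalSpace 𝔨 𝕃)] [∀ x, TopologicalSpace (𝕃 x)]
  [∀ x, LieRing (𝕃 x)] [∀ x, LieAlgebra ℝ (𝕃 x)] [FiberBundle 𝔨 𝕃] [VectorBundle ℝ 𝔨 𝕃]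
  [hL : IsLieAlgebraBundle 𝓘(ℝ, E) 𝔨 𝕃] {k : ℕ∞}

/-- A section is a combination of spanning sections, with coefficients that vanish where the
section does. -/
theorem exists_eq_sum_funSMul {ι : Type*} [Fintype ι] (Z : ι → Cₛ^k⟮𝓘(ℝ, E); 𝔨, 𝕃⟯)
    (hZ : ∀ x, Submodule.span ℝ (Set.range fun a ↦ Z a x) = ⊤) (X : Cₛ^k⟮𝓘(ℝ, E); 𝔨, 𝕃⟯) :
    ∃ c : ι → C^k⟮𝓘(ℝ, E), M; 𝓘(ℝ, ℝ), ℝ⟯, X = ∑ a, funSMul (c a) (Z a) ∧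
      ∀ x, X x = 0 → ∀ a, c a x = 0 := by
  -- The admissible coefficient vectors at each point form a convex set, so local solutions can be
  -- glued by a partition of unity.
  obtain ⟨g, hg⟩ := exists_contMDiffMap_forall_mem_convex_of_local (n := k) 𝓘(ℝ, E)
    (t := fun x ↦ {c : ι → ℝ | ∑ a, c a • Z a x = X x ∧ (X x = 0 → c = 0)})
    (fun x c hc c' hc' s t _ _ hst ↦ by
      refine ⟨?_, fun h ↦ by rw [hc.2 h, hc'.2 h, smul_zero, smul_zero, add_zero]⟩
      simp only [Pi.add_apply, Pi.smul_apply, add_smul, smul_assoc, Finset.sum_add_distrib,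
        ← Finset.smul_sum, hc.1, hc'.1]
      rw [← add_smul, hst, one_smul])
    (fun x₀ ↦ by
      obtain ⟨e, hx, he⟩ := hL.exists_chart x₀
      let loc (Y : Cₛ^k⟮𝓘(ℝ, E); 𝔨, 𝕃⟯) (y : M) : 𝔨 := (e ⟨y, Y y⟩).2
      have hloc (Y : Cₛ^k⟮𝓘(ℝ, E); 𝔨, 𝕃⟯) {y : M} (hy : y ∈ e.baseSet) :
          ContMDiffAt 𝓘(ℝ, E) 𝓘(ℝ, 𝔨) k (loc Y) y :=
        (he.contMDiffAt_section_iff hy).1 (Y.contMDiff y)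
      let T (y : M) : (ι → ℝ) →ₗ[ℝ] 𝔨 := Fintype.linearCombination ℝ fun a ↦ loc (Z a) y
      have hT₀ : LinearMap.range (T x₀) = ⊤ := by
        rw [Fintype.range_linearCombination]
        exact (he.span_range_eq_top_iff hx _).1 (hZ x₀)
      -- With `R` a right inverse of `T x₀`, the operator `A y = T y ∘ R` is the identity at `x₀`
      -- and invertible nearby. The coefficients `R (A y)⁻¹ X(y)` solve the equation there and
      -- vanish with `X(y)`.
      obtain ⟨R, hR⟩ := (T x₀).exists_rightInverse_of_surjective hT₀
      let ρ (a : ι) : 𝔨 →L[ℝ] ℝ := ((LinearMap.proj a) ∘ₗ R).toContinuousLinearMap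
      let A (y : M) : 𝔨 →L[ℝ] 𝔨 := ∑ a, ContinuousLinearMap.smulRightL ℝ 𝔨 𝔨 (ρ a) (loc (Z a) y)
      have hA (y : M) (v : 𝔨) : A y v = T y (R v) := by
        simp [A, T, ρ, Fintype.linearCombination_apply]
      have hAx : A x₀ = 1 := by
        ext v
        rw [hA, ← LinearMap.comp_apply, hR]
        rfl
      have hAsm {y : M} (hy : y ∈ e.baseSet) :
          ContMDiffAt 𝓘(ℝ, E) 𝓘(ℝ, 𝔨 →L[ℝ] 𝔨) k A y :=
        ContMDiffAt.sum fun a _ ↦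
          ((ContinuousLinearMap.smulRightL ℝ 𝔨 𝔨 (ρ a)).contDiff.contMDiff.contMDiffAt).comp y
            (hloc (Z a) hy)
      let U : Set M := {y | y ∈ e.baseSet ∧ IsUnit (A y)}
      have hU : U ∈ nhds x₀ := by
        refine Filter.inter_mem (e.open_baseSet.mem_nhds hx)
          ((hAsm hx).continuousAt.preimage_mem_nhds (Units.isOpen.mem_nhds ?_))
        rw [hAx]
        exact isUnit_one
      let c (y : M) : ι → ℝ := fun a ↦ ρ a (Ring.inverse (A y) (loc X y))
      refine ⟨U, hU, c, fun y hy ↦ ContMDiffAt.contMDiffWithinAt ?_, fun y hy ↦ ⟨?_, fun h0 ↦ ?_⟩⟩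
      · rw [contMDiffAt_pi_space]
        intro a
        have hinv : ContMDiffAt 𝓘(ℝ, E) 𝓘(ℝ, 𝔨 →L[ℝ] 𝔨) k (fun y ↦ Ring.inverse (A y)) y := by
          obtain ⟨u, hu⟩ := hy.2
          have := contDiffAt_ringInverse ℝ (n := k) u
          rw [hu] at this
          exact this.contMDiffAt.comp y (hAsm hy.1)
        exact ((ρ a).contDiff.contMDiff.contMDiffAt).comp y (hinv.clm_apply (hloc X hy.1))
      · have h1 : A y (Ring.inverse (A y) (loc X y)) = loc X y := by
          rw [← mul_apply_eq_comp, Ring.mul_inverse_cancel _ hy.2]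
          rfl
        refine (he.lieEquivAt hy.1).injective ?_
        rw [hA] at h1
        refine Eq.trans ?_ h1
        rw [Fintype.linearCombination_apply, map_sum]
        exact Finset.sum_congr rfl fun a _ ↦ map_smul (he.lieEquivAt hy.1) _ _
      · have : loc X y = 0 := by
          change he.lieEquivAt hy.1 (X y) = 0
          rw [h0, map_zero]
        funext a
        simp only [c, this, map_zero, Pi.zero_apply])
  refine ⟨fun a ↦ ⟨fun y ↦ g y a, fun y ↦ contMDiffAt_pi_space.1 (g.contMDiff y) a⟩,
    ContMDiffSection.ext fun x ↦ ?_, fun x hx a ↦ congrFun ((hg x).2 hx) a⟩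
  rw [ContMDiffSection.sum_apply]
  exact (hg x).1.symm

omit hL [FiniteDimensional ℝ E] [IsManifold 𝓘(ℝ, E) ∞ M] [T2Space M] [SigmaCompactSpace M]
  [FiniteDimensional ℝ 𝔨] [VectorBundle ℝ 𝔨 𝕃] in
/-- In a perfect fibre, the brackets of spanning vectors span. -/
theorem span_range_lie_eq_top
    (hperf : (⁅(⊤ : LieIdeal ℝ 𝔨), (⊤ : LieIdeal ℝ 𝔨)⁆ : LieIdeal ℝ 𝔨) = ⊤)
    {e : Trivialization 𝔨 (π 𝔨 𝕃)} (he : IsLieBundleChart 𝓘(ℝ, E) e) {x : M} (hx : x ∈ e.baseSet)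
    {ι : Type*} (v : ι → 𝕃 x) (hv : Submodule.span ℝ (Set.range v) = ⊤) :
    Submodule.span ℝ (Set.range fun p : ι × ι ↦ ⁅v p.1, v p.2⁆) = ⊤ := by
  rw [he.span_range_eq_top_iff hx] at hv ⊢
  set w : ι → 𝔨 := fun i ↦ (e ⟨x, v i⟩).2 with hw
  have h1 : (fun p : ι × ι ↦ (e ⟨x, ⁅v p.1, v p.2⁆⟩).2) = fun p ↦ ⁅w p.1, w p.2⁆ :=
    funext fun p ↦ he.map_lie x hx _ _
  rw [h1]
  set P := Submodule.span ℝ (Set.range fun p : ι × ι ↦ ⁅w p.1, w p.2⁆)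
  have hP (a b : 𝔨) : ⁅a, b⁆ ∈ P := by
    have ha : a ∈ Submodule.span ℝ (Set.range w) := hv ▸ Submodule.mem_top
    have hb : b ∈ Submodule.span ℝ (Set.range w) := hv ▸ Submodule.mem_top
    induction ha, hb using Submodule.span_induction₂ with
    | mem_mem a b ha hb =>
      obtain ⟨i, rfl⟩ := ha
      obtain ⟨j, rfl⟩ := hb
      exact Submodule.subset_span ⟨(i, j), rfl⟩
    | zero_left b => rw [zero_lie]; exact P.zero_mem
    | zero_right a => rw [lie_zero]; exact P.zero_mem
    | add_left a a' b _ _ _ h h' => rw [add_lie]; exact P.add_mem h h'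
    | add_right a b b' _ _ _ h h' => rw [lie_add]; exact P.add_mem h h'
    | smul_left c a b _ _ h => rw [smul_lie]; exact P.smul_mem _ h
    | smul_right c a b _ _ h => rw [lie_smul]; exact P.smul_mem _ h
  rw [eq_top_iff, ← LieSubmodule.top_toSubmodule (R := ℝ) (L := 𝔨), ← hperf,
    LieSubmodule.lieIdeal_oper_eq_linear_span, Submodule.span_le]
  rintro _ ⟨a, b, rfl⟩
  exact hP _ _

variable [Nonempty M]

/-- Complex structures on the Lie algebra of sections are linear over functions. -/
theorem IsLieComplexStructure.map_funSMul
    (hk : (⁅(⊤ : LieIdeal ℝ 𝔨), (⊤ : LieIdeal ℝ 𝔨)⁆ : LieIdeal ℝ 𝔨) = ⊤ ∨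
      ∀ z : 𝔨, (∀ x : 𝔨, ⁅x, z⁆ = 0) → z = 0)
    {J : Cₛ^k⟮𝓘(ℝ, E); 𝔨, 𝕃⟯ →ₗ[ℝ] Cₛ^k⟮𝓘(ℝ, E); 𝔨, 𝕃⟯} (hJ : IsLieComplexStructure J)
    (f : C^k⟮𝓘(ℝ, E), M; 𝓘(ℝ, ℝ), ℝ⟯) (X : Cₛ^k⟮𝓘(ℝ, E); 𝔨, 𝕃⟯) :
    J (funSMul f X) = funSMul f (J X) := by
  have key (A B : Cₛ^k⟮𝓘(ℝ, E); 𝔨, 𝕃⟯) : J (funSMul f ⁅A, B⁆) = funSMul f (J ⁅A, B⁆) := by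
    rw [← lie_funSMul, hJ.map_lie_left, lie_funSMul, hJ.map_lie_left]
  rcases hk with hk | hk
  · obtain ⟨N, S, hS⟩ := exists_section_span E 𝔨 𝕃
    obtain ⟨c, hc, -⟩ := exists_eq_sum_funSMul
      (fun p : Fin N × Fin N ↦ ⁅ofSmooth k (S p.1), ofSmooth k (S p.2)⁆)
      (fun x ↦ by
        obtain ⟨e, hx, he⟩ := hL.exists_chart x
        exact span_range_lie_eq_top hk he hx (fun i ↦ S i x) (hS x)) X
    -- The defect of linearity over `f` is additive and kills all `funSMul (c p) ⁅A, B⁆`, since `c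
    -- p` can be absorbed into `B`.
    let D : Cₛ^k⟮𝓘(ℝ, E); 𝔨, 𝕃⟯ →ₗ[ℝ] Cₛ^k⟮𝓘(ℝ, E); 𝔨, 𝕃⟯ :=
      { toFun := fun Y ↦ J (funSMul f Y) - funSMul f (J Y)
        map_add' := fun Y Z ↦ by
          have h (Y Z : Cₛ^k⟮𝓘(ℝ, E); 𝔨, 𝕃⟯) : funSMul f (Y + Z) = funSMul f Y + funSMul f Z :=
            ContMDiffSection.ext fun x ↦ smul_add (f x) (Y x) (Z x)
          rw [h, map_add, map_add, h]
          abel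
        map_smul' := fun r Y ↦ by
          have h (Y : Cₛ^k⟮𝓘(ℝ, E); 𝔨, 𝕃⟯) : funSMul f (r • Y) = r • funSMul f Y :=
            ContMDiffSection.ext fun x ↦ smul_comm (f x) r (Y x)
          rw [h, map_smul, map_smul, h, RingHom.id_apply, smul_sub] }
    have hD : D X = 0 := by
      rw [hc, map_sum]
      refine Finset.sum_eq_zero fun p _ ↦ sub_eq_zero.2 ?_
      rw [← lie_funSMul, key]
    exact sub_eq_zero.1 hD
  · ext x
    obtain ⟨e, hx, he⟩ := hL.exists_chart x
    refine sub_eq_zero.1 ((he.lieEquivAt hx).injective ?_)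
    rw [map_zero]
    refine hk _ fun a ↦ ?_
    obtain ⟨Y, hY⟩ := exists_apply_eq (I := 𝓘(ℝ, E)) (𝔨 := 𝔨) (k := k) x ((he.lieEquivAt hx).symm a)
    -- The defect brackets to zero with every section. Sections attain every vector of the fibre, so
    -- its value at `x` is central.
    have h1 : ⁅Y, J (funSMul f X) - funSMul f (J X)⁆ = 0 := by
      rw [lie_sub, lie_funSMul, ← hJ.1, ← hJ.1, lie_funSMul, key, sub_self]
    have h2 : ⁅Y x, J (funSMul f X) x - funSMul f (J X) x⁆ = 0 := DFunLike.congr_fun h1 x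
    rw [hY] at h2
    rw [← (he.lieEquivAt hx).apply_symm_apply a]
    exact ((he.lieEquivAt hx).map_lie _ _).symm.trans
      ((congrArg (he.lieEquivAt hx) h2).trans (map_zero _))

/-- Complex structures on the Lie algebra of sections are given by complex structures on the
fibres. -/
theorem IsLieComplexStructure.exists_fibrewise
    (hk : (⁅(⊤ : LieIdeal ℝ 𝔨), (⊤ : LieIdeal ℝ 𝔨)⁆ : LieIdeal ℝ 𝔨) = ⊤ ∨
      ∀ z : 𝔨, (∀ x : 𝔨, ⁅x, z⁆ = 0) → z = 0)
    {J : Cₛ^k⟮𝓘(ℝ, E); 𝔨, 𝕃⟯ →ₗ[ℝ] Cₛ^k⟮𝓘(ℝ, E); 𝔨, 𝕃⟯} (hJ : IsLieComplexStructure J) :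
    ∃ j : ∀ x, 𝕃 x →ₗ[ℝ] 𝕃 x, (∀ x, IsLieComplexStructure (j x)) ∧ ∀ X x, J X x = j x (X x) := by
  obtain ⟨N, S, hS⟩ := exists_section_span E 𝔨 𝕃
  have hzero (X : Cₛ^k⟮𝓘(ℝ, E); 𝔨, 𝕃⟯) (x : M) (hX : X x = 0) : J X x = 0 := by
    obtain ⟨c, hc, hc0⟩ := exists_eq_sum_funSMul (fun i ↦ ofSmooth k (S i)) hS X
    rw [hc, map_sum, ContMDiffSection.sum_apply]
    refine Finset.sum_eq_zero fun i _ ↦ ?_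
    rw [hJ.map_funSMul hk, funSMul_apply, hc0 x hX, zero_smul]
  have hsurj (x : M) : LinearMap.range (evalₗ 𝓘(ℝ, E) 𝔨 𝕃 k x) = ⊤ :=
    LinearMap.range_eq_top.2 fun v ↦ exists_apply_eq x v
  -- `σ x` extends vectors at `x` linearly to sections; by `hzero` the value of `J` at `x` does not
  -- depend on the extension.
  choose σ hσ using fun x ↦ (evalₗ 𝓘(ℝ, E) 𝔨 𝕃 k x).exists_rightInverse_of_surjective (hsurj x)
  have hσx (x : M) (v : 𝕃 x) : σ x v x = v := LinearMap.congr_fun (hσ x) v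
  have hj (X : Cₛ^k⟮𝓘(ℝ, E); 𝔨, 𝕃⟯) (x : M) : J X x = J (σ x (X x)) x := by
    have h := hzero (X - σ x (X x)) x (by
      rw [coe_sub, Pi.sub_apply, hσx, sub_self])
    rwa [map_sub, coe_sub, Pi.sub_apply, sub_eq_zero] at h
  refine ⟨fun x ↦ evalₗ 𝓘(ℝ, E) 𝔨 𝕃 k x ∘ₗ J ∘ₗ σ x, fun x ↦ ⟨fun v w ↦ ?_, fun v ↦ ?_⟩, hj⟩
  · change J (σ x ⁅v, w⁆) x = ⁅v, J (σ x w) x⁆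
    have h : ⁅σ x v, σ x w⁆ x = ⁅v, w⁆ := by
      rw [IsLieAlgebraBundle.lie_apply, hσx, hσx]
    rw [← h, ← hj, hJ.1, IsLieAlgebraBundle.lie_apply, hσx]
  · change J (σ x (J (σ x v) x)) x = -v
    rw [← hj, hJ.2, coe_neg, Pi.neg_apply, hσx]

end Fibrewise

/-! ### Uniqueness of complex structures up to sign -/

section Uniqueness

open ContMDiffSection

variable {E : Type*} [NormedAddCommGroup E] [NormedSpace ℝ E]
  {M : Type*} [TopologicalSpace M] [ChartedSpace E M]
  {𝔨 : Type*} [NormedGroupLieRing 𝔨] [NormedSpaceLieAlgebra 𝔨]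
  {𝕃 : M → Type*} [TopologicalSpace (TotalSpace 𝔨 𝕃)] [∀ x, TopologicalSpace (𝕃 x)]
  [∀ x, LieRing (𝕃 x)] [∀ x, LieAlgebra ℝ (𝕃 x)] [FiberBundle 𝔨 𝕃]

/-- The typical fibre is isomorphic to every fibre. -/
theorem IsLieAlgebraBundle.nonempty_lieEquiv (h : IsLieAlgebraBundle 𝓘(ℝ, E) 𝔨 𝕃) (x : M) :
    Nonempty (𝕃 x ≃ₗ⁅ℝ⁆ 𝔨) := by
  obtain ⟨e, hx, he⟩ := h.exists_chart x
  exact ⟨he.lieEquivAt hx⟩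

/-- Two complex structures agree up to sign if this holds on an isomorphic Lie algebra. -/
theorem IsLieComplexStructure.eq_or_eq_neg_of_lieEquiv {𝔤 𝔥 : Type*} [LieRing 𝔤] [LieAlgebra ℝ 𝔤]
    [LieRing 𝔥] [LieAlgebra ℝ 𝔥] (φ : 𝔤 ≃ₗ⁅ℝ⁆ 𝔥) (h_indec : IsIndecomposableLie 𝔥)
    (h : (⁅(⊤ : LieIdeal ℝ 𝔥), (⊤ : LieIdeal ℝ 𝔥)⁆ : LieIdeal ℝ 𝔥) = ⊤ ∨
      ∀ z : 𝔥, (∀ x : 𝔥, ⁅x, z⁆ = 0) → z = 0)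
    {j j' : 𝔤 →ₗ[ℝ] 𝔤} (hj : IsLieComplexStructure j)
    (hj' : IsLieComplexStructure j') : j' = j ∨ j' = -j := by
  refine ((hj.conj φ).eq_or_eq_neg h_indec h (hj'.conj φ)).imp (fun h ↦ ?_) fun h ↦ ?_
  · exact φ.toLinearEquiv.conj.injective h
  · exact φ.toLinearEquiv.conj.injective (h.trans (map_neg φ.toLinearEquiv.conj j).symm)

variable [hL : IsLieAlgebraBundle 𝓘(ℝ, E) 𝔨 𝕃] {k : ℕ∞}

theorem isClosed_section_eq_zero [VectorBundle ℝ 𝔨 𝕃] (X : Cₛ^k⟮𝓘(ℝ, E); 𝔨, 𝕃⟯) :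
    IsClosed {x | X x = 0} := by
  rw [← isOpen_compl_iff, isOpen_iff_mem_nhds]
  intro x hx
  obtain ⟨e, hxe, he⟩ := hL.exists_chart x
  have hcont := ((he.contMDiffAt_section_iff hxe).1 (X.contMDiff x)).continuousAt
  have hne : (e ⟨x, X x⟩).2 ≠ 0 := fun h ↦ hx ((he.lieEquivAt hxe).injective (h.trans (map_zero
    (he.lieEquivAt hxe)).symm))
  filter_upwards [hcont.eventually_ne hne, e.open_baseSet.mem_nhds hxe] with y hy hye h0
  have h0 : X y = 0 := h0
  refine hy ?_
  rw [h0]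
  exact map_zero (he.lieEquivAt hye)

variable [VectorBundle ℝ 𝔨 𝕃] [FiniteDimensional ℝ E] [IsManifold 𝓘(ℝ, E) ∞ M] [T2Space M]
  [SigmaCompactSpace M] [FiniteDimensional ℝ 𝔨] [ConnectedSpace M]

/-- Complex structures on the Lie algebra of sections agree up to sign. -/
theorem IsLieComplexStructure.eq_or_eq_neg_of_section (h_indec : IsIndecomposableLie 𝔨)
    (hk : (⁅(⊤ : LieIdeal ℝ 𝔨), (⊤ : LieIdeal ℝ 𝔨)⁆ : LieIdeal ℝ 𝔨) = ⊤ ∨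
      ∀ z : 𝔨, (∀ x : 𝔨, ⁅x, z⁆ = 0) → z = 0)
    {J J' : Cₛ^k⟮𝓘(ℝ, E); 𝔨, 𝕃⟯ →ₗ[ℝ] Cₛ^k⟮𝓘(ℝ, E); 𝔨, 𝕃⟯} (hJ : IsLieComplexStructure J)
    (hJ' : IsLieComplexStructure J') : J' = J ∨ J' = -J := by
  -- The zero algebra counts as indecomposable, and over it the sets `P` and `Q` below would not be
  -- disjoint.
  rcases subsingleton_or_nontrivial 𝔨 with h𝔨 | h𝔨
  · refine Or.inl (LinearMap.ext fun X ↦ ContMDiffSection.ext fun x ↦ ?_)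
    obtain ⟨φ⟩ := hL.nonempty_lieEquiv x
    exact φ.injective (Subsingleton.elim _ _)
  obtain ⟨j, hj, hjX⟩ := hJ.exists_fibrewise hk
  obtain ⟨j', hj', hj'X⟩ := hJ'.exists_fibrewise hk
  let P : Set M := ⋂ X, {x | (J' X - J X) x = 0}
  let Q : Set M := ⋂ X, {x | (J' X + J X) x = 0}
  have hP (x : M) : x ∈ P ↔ ∀ X, J' X x = J X x := by
    simp [P, sub_eq_zero]
  have hQ (x : M) : x ∈ Q ↔ ∀ X, J' X x = -J X x := by
    simp [Q, eq_neg_iff_add_eq_zero]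
  have hPQ (x : M) : x ∈ P ∨ x ∈ Q := by
    rw [hP, hQ]
    obtain ⟨φ⟩ := hL.nonempty_lieEquiv x
    refine (IsLieComplexStructure.eq_or_eq_neg_of_lieEquiv φ h_indec hk (hj x) (hj' x)).imp
      (fun h X ↦ ?_) fun h X ↦ ?_
    · rw [hj'X, hjX, h]
    · rw [hj'X, hjX, h, LinearMap.neg_apply]
  have hdisj (x : M) (h1 : x ∈ P) (h2 : x ∈ Q) : False := by
    obtain ⟨φ⟩ := hL.nonempty_lieEquiv x
    obtain ⟨v, hv⟩ := exists_ne (0 : 𝔨)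
    obtain ⟨X, hX⟩ := exists_apply_eq (I := 𝓘(ℝ, E)) (𝔨 := 𝔨) (k := k) x (φ.symm v)
    have h3 : J (J X) x = -J (J X) x := ((hP x).1 h1 (J X)).symm.trans ((hQ x).1 h2 (J X))
    rw [hJ.2, coe_neg, Pi.neg_apply, neg_neg, eq_comm, eq_neg_iff_add_eq_zero, ← two_smul ℝ,
      smul_eq_zero, hX] at h3
    exact hv (φ.symm.injective ((h3.resolve_left two_ne_zero).trans (map_zero φ.symm).symm))
  have hclP : IsClosed P := isClosed_iInter fun X ↦ isClosed_section_eq_zero _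
  have hclQ : IsClosed Q := isClosed_iInter fun X ↦ isClosed_section_eq_zero _
  have hcompl : Pᶜ = Q := Set.ext fun x ↦
    ⟨fun h ↦ (hPQ x).resolve_left h, fun h2 h1 ↦ hdisj x h1 h2⟩
  have hclopen : IsClopen P := ⟨hclP, by rw [← isClosed_compl_iff, hcompl]; exact hclQ⟩
  rcases isClopen_iff.1 hclopen with h | h
  · refine Or.inr (LinearMap.ext fun X ↦ ContMDiffSection.ext fun x ↦ ?_)
    refine (hQ x).1 (hcompl ▸ ?_) X
    rw [h]
    exact Set.notMem_empty x
  · refine Or.inl (LinearMap.ext fun X ↦ ContMDiffSection.ext fun x ↦ ?_)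
    exact (hP x).1 (h ▸ Set.mem_univ x) X

end Uniqueness

/-! ### Coboundaries in first Čech cohomology -/

namespace Cech

variable {M : Type*} [TopologicalSpace M] {G : Type*}

theorem _root_.LocallyConstant.eventually_eq_subtype {U : Opens M} (f : LocallyConstant U G) {x : M}
    (hx : x ∈ U) : ∀ᶠ y in nhds x, ∀ hy : y ∈ U, f ⟨y, hy⟩ = f ⟨x, hx⟩ := by
  have h := f.isLocallyConstant.eventually_eq ⟨x, hx⟩
  rw [nhds_subtype_eq_comap, Filter.eventually_comap] at h
  exact h.mono fun y hy hyU ↦ hy ⟨y, hyU⟩ rfl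

theorem _root_.IsLocallyConstant.of_eventually_subtype {U : Opens M} {f : U → G}
    (h : ∀ (x : M) (hx : x ∈ U), ∀ᶠ y in nhds x, ∀ hy : y ∈ U, f ⟨y, hy⟩ = f ⟨x, hx⟩) :
    IsLocallyConstant f := by
  rw [IsLocallyConstant.iff_eventually_eq]
  rintro ⟨x, hx⟩
  rw [nhds_subtype_eq_comap, Filter.eventually_comap]
  filter_upwards [h x hx] with y hy
  rintro ⟨_, hyU⟩ rfl
  exact hy hyU

variable [Group G]

/-- A cocycle is a coboundary if it has the form `h_V h_U⁻¹` on its cover. -/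
def Cocycle.IsCoboundary {𝔙 : Cover M} (g : Cocycle G 𝔙) : Prop :=
  ∃ h : ∀ U : 𝔙.sets, LocallyConstant ↥(U : Opens M) G,
    ∀ (U V : 𝔙.sets) (x : M) (hU : x ∈ (U : Opens M)) (hV : x ∈ (V : Opens M)),
      g.g V U ⟨x, hV, hU⟩ = h V ⟨x, hV⟩ * (h U ⟨x, hU⟩)⁻¹

/-- The cocycle with all values equal to `1`. -/
def Cocycle.trivial (G : Type*) [Group G] (𝔙 : Cover M) : Cocycle G 𝔙 where
  g _ _ := 1
  cocycle _ _ _ _ _ _ _ := by simp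

theorem Cocycle.isCoboundary_trivial (𝔙 : Cover M) : (Cocycle.trivial G 𝔙).IsCoboundary :=
  ⟨fun _ ↦ 1, fun _ _ _ _ _ ↦ by simp [Cocycle.trivial]⟩

/-- The cocycle identity in its usual form, in a group without `3`-torsion. -/
theorem Cocycle.g_mul_g (hG : ∀ a : G, a * a * a = 1 → a = 1) {𝔙 : Cover M} (g : Cocycle G 𝔙)
    (U V W : 𝔙.sets) {x : M} (hU : x ∈ (U : Opens M)) (hV : x ∈ (V : Opens M))
    (hW : x ∈ (W : Opens M)) :
    g.g V U ⟨x, hV, hU⟩ * g.g U W ⟨x, hU, hW⟩ = g.g V W ⟨x, hV, hW⟩ := by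
  -- With three equal indices the cocycle condition only says that the cube of `g V V` is `1`.
  have h1 := hG _ (g.cocycle V V V x hV hV hV)
  have h2 := g.cocycle W V V x hW hV hV
  rw [h1, mul_one] at h2
  rw [eq_inv_of_mul_eq_one_left h2]
  exact eq_inv_of_mul_eq_one_left (g.cocycle U V W x hU hV hW)

theorem LimitRel.symm {a b : Σ 𝔙 : Cover M, Cocycle G 𝔙} (h : LimitRel a b) : LimitRel b a := by
  obtain ⟨𝔚, r, hr, s, hs, h, hh⟩ := h
  refine ⟨𝔚, s, hs, r, hr, fun U ↦ (h U)⁻¹, fun U V x hU hV ↦ ?_⟩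
  rw [hh U V x hU hV]
  simp [mul_assoc]

/-- `H1` is the quotient by the relation generated by `LimitRel`, so invariance under a single step
makes being a coboundary a property of classes. A trivialization on a refinement descends to the
original cover because the cocycle identity makes its transported local pieces agree. -/
theorem LimitRel.isCoboundary (hG : ∀ a : G, a * a * a = 1 → a = 1)
    {a b : Σ 𝔙 : Cover M, Cocycle G 𝔙} (hab : LimitRel a b) (ha : a.2.IsCoboundary) :
    b.2.IsCoboundary := by
  obtain ⟨𝔚, r, hr, s, hs, h, hh⟩ := hab
  obtain ⟨α, hα⟩ := ha
  choose w hw hwx using 𝔚.covers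
  -- The trivialization over `W`, carried to `U` by the cocycle `b`; `hβ` shows that it does not
  -- depend on `W`.
  let β (U : b.1.sets) (W : 𝔚.sets) (x : M) (hU : x ∈ (U : Opens M)) (hW : x ∈ (W : Opens M)) : G :=
    b.2.g U (s W) ⟨x, hU, hs W hW⟩ * h W ⟨x, hW⟩ * α (r W) ⟨x, hr W hW⟩
  have hb (W W' : 𝔚.sets) (x : M) (hW : x ∈ (W : Opens M)) (hW' : x ∈ (W' : Opens M)) :
      b.2.g (s W') (s W) ⟨x, hs W' hW', hs W hW⟩ =
        h W' ⟨x, hW'⟩ * α (r W') ⟨x, hr W' hW'⟩ *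
          (h W ⟨x, hW⟩ * α (r W) ⟨x, hr W hW⟩)⁻¹ := by
    have h1 : b.2.g (s W') (s W) ⟨x, hs W' hW', hs W hW⟩ = h W' ⟨x, hW'⟩ *
        a.2.g (r W') (r W) ⟨x, hr W' hW', hr W hW⟩ * (h W ⟨x, hW⟩)⁻¹ := hh W W' x hW hW'
    rw [h1, hα (r W) (r W') x (hr W hW) (hr W' hW')]
    group
  have hβ (U : b.1.sets) (W W' : 𝔚.sets) (x : M) (hU : x ∈ (U : Opens M))
      (hW : x ∈ (W : Opens M)) (hW' : x ∈ (W' : Opens M)) : β U W x hU hW = β U W' x hU hW' := by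
    simp only [β]
    rw [← b.2.g_mul_g hG (s W') U (s W) (hs W' hW') hU (hs W hW), hb W W' x hW hW']
    group
  have hloc (U : b.1.sets) : IsLocallyConstant fun x : (U : Opens M) ↦
      β U ⟨w x, hw x⟩ x x.2 (hwx x) := by
    refine IsLocallyConstant.of_eventually_subtype fun x hx ↦ ?_
    have hW : x ∈ w x := hwx x
    filter_upwards [(w x).isOpen.mem_nhds hW,
      (b.2.g U (s ⟨w x, hw x⟩)).eventually_eq_subtype ⟨hx, hs ⟨w x, hw x⟩ hW⟩,
      (h ⟨w x, hw x⟩).eventually_eq_subtype hW,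
      (α (r ⟨w x, hw x⟩)).eventually_eq_subtype (hr ⟨w x, hw x⟩ hW)] with y hyW h1 h2 h3 hyU
    have hyW : y ∈ w x := hyW
    refine (hβ U ⟨w y, hw y⟩ ⟨w x, hw x⟩ y hyU (hwx y) hyW).trans ?_
    change b.2.g U (s ⟨w x, hw x⟩) ⟨y, hyU, hs ⟨w x, hw x⟩ hyW⟩ * h ⟨w x, hw x⟩ ⟨y, hyW⟩ *
      α (r ⟨w x, hw x⟩) ⟨y, hr ⟨w x, hw x⟩ hyW⟩ = _
    rw [h1 ⟨hyU, hs ⟨w x, hw x⟩ hyW⟩, h2 hyW, h3 (hr ⟨w x, hw x⟩ hyW)]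
  refine ⟨fun U ↦ ⟨_, hloc U⟩, fun U V x hU hV ↦ ?_⟩
  have hW : x ∈ w x := hwx x
  have h1 := b.2.g_mul_g hG U V (s ⟨w x, hw x⟩) hU hV (hs ⟨w x, hw x⟩ hW)
  change _ = b.2.g V (s ⟨w x, hw x⟩) ⟨x, hV, hs ⟨w x, hw x⟩ hW⟩ * _ * _ *
    (b.2.g U (s ⟨w x, hw x⟩) ⟨x, hU, hs ⟨w x, hw x⟩ hW⟩ * _ * _)⁻¹
  rw [← h1]
  group

/-- If the first Čech cohomology is trivial, then every cocycle is a coboundary. -/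
theorem isCoboundary_of_subsingleton_H1 (hG : ∀ a : G, a * a * a = 1 → a = 1)
    (hH : Subsingleton (H1 M G)) {𝔙 : Cover M} (g : Cocycle G 𝔙) : g.IsCoboundary := by
  let P : H1 M G → Prop := Quot.lift (fun a ↦ a.2.IsCoboundary) fun a b h ↦
    propext ⟨h.isCoboundary hG, h.symm.isCoboundary hG⟩
  have h := congrArg P (hH.elim (Quot.mk _ ⟨𝔙, g⟩) (Quot.mk _ ⟨𝔙, Cocycle.trivial G 𝔙⟩))
  change g.IsCoboundary = (Cocycle.trivial G 𝔙).IsCoboundary at h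
  rw [h]
  exact Cocycle.isCoboundary_trivial 𝔙

end Cech

/-! ### Existence of complex structures -/

/-- The non-trivial character of the group with two elements. -/
noncomputable def zmodTwoSign (a : Multiplicative (ZMod 2)) : ℝ := if a = 1 then 1 else -1

theorem zmodTwo_eq_one_or (a : Multiplicative (ZMod 2)) : a = 1 ∨ a = Multiplicative.ofAdd 1 := by
  revert a; decide

theorem zmodTwoSign_one : zmodTwoSign 1 = 1 := if_pos rfl

theorem zmodTwoSign_ofAdd_one : zmodTwoSign (Multiplicative.ofAdd 1) = -1 := if_neg (by decide)

theorem zmodTwoSign_mul (a b : Multiplicative (ZMod 2)) :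
    zmodTwoSign (a * b) = zmodTwoSign a * zmodTwoSign b := by
  have h : (Multiplicative.ofAdd 1 * Multiplicative.ofAdd 1 : Multiplicative (ZMod 2)) = 1 := by
    decide
  rcases zmodTwo_eq_one_or a with rfl | rfl <;> rcases zmodTwo_eq_one_or b with rfl | rfl <;>
    simp [zmodTwoSign_one, zmodTwoSign_ofAdd_one, h]

theorem zmodTwoSign_mul_self (a : Multiplicative (ZMod 2)) :
    zmodTwoSign a * zmodTwoSign a = 1 := by
  rcases zmodTwo_eq_one_or a with rfl | rfl <;> simp [zmodTwoSign_one, zmodTwoSign_ofAdd_one]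

theorem eq_one_of_zmodTwoSign_eq_one {a : Multiplicative (ZMod 2)} (h : zmodTwoSign a = 1) :
    a = 1 := by
  rcases zmodTwo_eq_one_or a with rfl | rfl
  · rfl
  · rw [zmodTwoSign_ofAdd_one] at h
    norm_num at h

theorem IsLieComplexStructure.zmodTwoSign_smul {𝔤 : Type*} [LieRing 𝔤] [LieAlgebra ℝ 𝔤]
    {J : 𝔤 →ₗ[ℝ] 𝔤} (hJ : IsLieComplexStructure J) (a : Multiplicative (ZMod 2)) :
    IsLieComplexStructure (zmodTwoSign a • J) := by
  rcases zmodTwo_eq_one_or a with rfl | rfl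
  · rwa [zmodTwoSign_one, one_smul]
  · rw [zmodTwoSign_ofAdd_one, neg_smul, one_smul]
    exact hJ.neg

section Existence

open ContMDiffSection

variable {E : Type*} [NormedAddCommGroup E] [NormedSpace ℝ E]
  {M : Type*} [TopologicalSpace M] [ChartedSpace E M]
  {𝔨 : Type*} [NormedGroupLieRing 𝔨] [NormedSpaceLieAlgebra 𝔨]
  {𝕃 : M → Type*} [TopologicalSpace (TotalSpace 𝔨 𝕃)] [∀ x, TopologicalSpace (𝕃 x)]
  [∀ x, LieRing (𝕃 x)] [∀ x, LieAlgebra ℝ (𝕃 x)] [FiberBundle 𝔨 𝕃]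
  {k : ℕ∞} {e : Trivialization 𝔨 (π 𝔨 𝕃)} {x : M}

open scoped Classical in
/-- The endomorphism of a fibre that corresponds to an endomorphism of the typical fibre in a
chart, and zero outside of the chart domain. -/
noncomputable def IsLieBundleChart.pullbackEnd (he : IsLieBundleChart 𝓘(ℝ, E) e) (J : 𝔨 →ₗ[ℝ] 𝔨)
    (x : M) : 𝕃 x →ₗ[ℝ] 𝕃 x :=
  if hx : x ∈ e.baseSet then (he.lieEquivAt hx).symm.toLinearEquiv.conj J else 0

namespace IsLieBundleChart

theorem pullbackEnd_of_mem (he : IsLieBundleChart 𝓘(ℝ, E) e) (J : 𝔨 →ₗ[ℝ] 𝔨)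
    (hx : x ∈ e.baseSet) :
    he.pullbackEnd J x = (he.lieEquivAt hx).symm.toLinearEquiv.conj J := dif_pos hx

theorem apply_pullbackEnd (he : IsLieBundleChart 𝓘(ℝ, E) e) (J : 𝔨 →ₗ[ℝ] 𝔨)
    (hx : x ∈ e.baseSet) (v : 𝕃 x) : (e ⟨x, he.pullbackEnd J x v⟩).2 = J (e ⟨x, v⟩).2 := by
  rw [he.pullbackEnd_of_mem J hx]
  exact (he.lieEquivAt hx).apply_symm_apply _

theorem isLieComplexStructure_pullbackEnd (he : IsLieBundleChart 𝓘(ℝ, E) e) {J : 𝔨 →ₗ[ℝ] 𝔨}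
    (hJ : IsLieComplexStructure J) (hx : x ∈ e.baseSet) :
    IsLieComplexStructure (he.pullbackEnd J x) := by
  rw [he.pullbackEnd_of_mem J hx]
  exact hJ.conj _

variable [FiniteDimensional ℝ 𝔨]

theorem contMDiffAt_pullbackEnd (he : IsLieBundleChart 𝓘(ℝ, E) e) (J : 𝔨 →ₗ[ℝ] 𝔨)
    (hx : x ∈ e.baseSet) {X : ∀ y, 𝕃 y}
    (hX : ContMDiffAt 𝓘(ℝ, E) (𝓘(ℝ, E).prod 𝓘(ℝ, 𝔨)) k (fun y ↦ TotalSpace.mk' 𝔨 y (X y)) x) :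
    ContMDiffAt 𝓘(ℝ, E) (𝓘(ℝ, E).prod 𝓘(ℝ, 𝔨)) k
      (fun y ↦ TotalSpace.mk' 𝔨 y (he.pullbackEnd J y (X y))) x := by
  rw [he.contMDiffAt_section_iff hx] at hX ⊢
  refine (J.toContinuousLinearMap.contDiff.contMDiff.contMDiffAt.comp x hX).congr_of_eventuallyEq ?_
  filter_upwards [e.open_baseSet.mem_nhds hx] with y hy
  exact he.apply_pullbackEnd J hy (X y)

/-- Whether the fibre structures obtained from two charts agree is locally constant. -/
theorem eventually_pullbackEnd_eq_iff [VectorBundle ℝ 𝔨 𝕃] [FiniteDimensional ℝ E]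
    [IsManifold 𝓘(ℝ, E) ∞ M] [T2Space M] [SigmaCompactSpace M] [IsLieAlgebraBundle 𝓘(ℝ, E) 𝔨 𝕃]
    [Nontrivial 𝔨] (h_indec : IsIndecomposableLie 𝔨)
    (hk : (⁅(⊤ : LieIdeal ℝ 𝔨), (⊤ : LieIdeal ℝ 𝔨)⁆ : LieIdeal ℝ 𝔨) = ⊤ ∨
      ∀ z : 𝔨, (∀ x : 𝔨, ⁅x, z⁆ = 0) → z = 0)
    {e' : Trivialization 𝔨 (π 𝔨 𝕃)} (he : IsLieBundleChart 𝓘(ℝ, E) e)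
    (he' : IsLieBundleChart 𝓘(ℝ, E) e') {J : 𝔨 →ₗ[ℝ] 𝔨} (hJ : IsLieComplexStructure J)
    (hx : x ∈ e.baseSet) (hx' : x ∈ e'.baseSet) :
    ∀ᶠ y in nhds x, (he.pullbackEnd J y = he'.pullbackEnd J y ↔
      he.pullbackEnd J x = he'.pullbackEnd J x) := by
  have hor {y : M} (hy : y ∈ e.baseSet) (hy' : y ∈ e'.baseSet) :=
    IsLieComplexStructure.eq_or_eq_neg_of_lieEquiv (he.lieEquivAt hy) h_indec hk
      (he'.isLieComplexStructure_pullbackEnd hJ hy') (he.isLieComplexStructure_pullbackEnd hJ hy)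
  -- A section `X` with `X x ≠ 0` detects the sign: its images under the two structures are
  -- continuous and nonzero at `x`, so the sign excluded at `x` stays excluded nearby.
  obtain ⟨v, hv⟩ := exists_ne (0 : 𝔨)
  obtain ⟨X, hX⟩ := exists_apply_eq (I := 𝓘(ℝ, E)) (𝔨 := 𝔨) (k := 0) x
    ((he.lieEquivAt hx).symm v)
  have hXx : X x ≠ 0 := fun h ↦ hv ((he.lieEquivAt hx).symm.injective
    (hX.symm.trans (h.trans (map_zero (he.lieEquivAt hx).symm).symm)))
  have h1 := ((he.contMDiffAt_section_iff hx).1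
    (he.contMDiffAt_pullbackEnd J hx (X.contMDiff x))).continuousAt
  have h2 := ((he.contMDiffAt_section_iff hx).1
    (he'.contMDiffAt_pullbackEnd J hx' (X.contMDiff x))).continuousAt
  have hne : he'.pullbackEnd J x (X x) ≠ 0 := fun h ↦ hXx (by
    have h3 := (he'.isLieComplexStructure_pullbackEnd hJ hx').2 (X x)
    rw [h, map_zero] at h3
    exact neg_eq_zero.1 h3.symm)
  have hsmul (w : 𝕃 x) (h : w = -w) : w = 0 := by
    rw [eq_neg_iff_add_eq_zero, ← two_smul ℝ, smul_eq_zero] at h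
    exact h.resolve_left two_ne_zero
  rcases hor hx hx' with h | h
  · have hlim : (e ⟨x, he.pullbackEnd J x (X x)⟩).2 ≠ -(e ⟨x, he'.pullbackEnd J x (X x)⟩).2 := by
      intro h3
      refine hne (hsmul _ ((he.lieEquivAt hx).injective ?_))
      rw [h] at h3
      exact h3.trans (map_neg (he.lieEquivAt hx) _).symm
    filter_upwards [h1.ne_iff_eventually_ne h2.neg |>.1 hlim, e.open_baseSet.mem_nhds hx,
      e'.open_baseSet.mem_nhds hx'] with y hy hye hye'
    refine iff_of_true ((hor hye hye').resolve_right fun h3 ↦ hy ?_) h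
    rw [h3]
    exact map_neg (he.lieEquivAt hye) (he'.pullbackEnd J y (X y))
  · have hlim : (e ⟨x, he.pullbackEnd J x (X x)⟩).2 ≠ (e ⟨x, he'.pullbackEnd J x (X x)⟩).2 := by
      intro h3
      refine hne (hsmul _ ((he.lieEquivAt hx).injective ?_))
      rw [h] at h3
      exact h3.symm
    filter_upwards [h1.ne_iff_eventually_ne h2 |>.1 hlim, e.open_baseSet.mem_nhds hx,
      e'.open_baseSet.mem_nhds hx'] with y hy hye hye'
    refine iff_of_false (fun h3 ↦ hy (by rw [h3])) fun h3 ↦ hne (hsmul _ ?_)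
    rw [h] at h3
    exact (LinearMap.congr_fun h3 (X x)).symm

end IsLieBundleChart

variable [VectorBundle ℝ 𝔨 𝕃] [FiniteDimensional ℝ 𝔨] [hL : IsLieAlgebraBundle 𝓘(ℝ, E) 𝔨 𝕃]

/-- A family of complex structures on the fibres that maps `C^k`-sections to `C^k`-sections is a
complex structure on the Lie algebra of sections. -/
theorem exists_isLieComplexStructure_of_fibrewise (j : ∀ x, 𝕃 x →ₗ[ℝ] 𝕃 x)
    (hj : ∀ x, IsLieComplexStructure (j x))
    (hsm : ∀ X : Cₛ^k⟮𝓘(ℝ, E); 𝔨, 𝕃⟯, ContMDiff 𝓘(ℝ, E) (𝓘(ℝ, E).prod 𝓘(ℝ, 𝔨)) k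
      (fun y ↦ TotalSpace.mk' 𝔨 y (j y (X y)))) :
    ∃ J : Cₛ^k⟮𝓘(ℝ, E); 𝔨, 𝕃⟯ →ₗ[ℝ] Cₛ^k⟮𝓘(ℝ, E); 𝔨, 𝕃⟯, IsLieComplexStructure J :=
  ⟨{ toFun := fun X ↦ ⟨fun y ↦ j y (X y), hsm X⟩
     map_add' := fun X Y ↦ ContMDiffSection.ext fun x ↦ map_add (j x) (X x) (Y x)
     map_smul' := fun c X ↦ ContMDiffSection.ext fun x ↦ map_smul (j x) c (X x) },
    fun X Y ↦ ContMDiffSection.ext fun x ↦ (hj x).1 (X x) (Y x),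
    fun X ↦ ContMDiffSection.ext fun x ↦ (hj x).2 (X x)⟩

open scoped Classical in
/-- A complex structure on the typical fibre induces one on the Lie algebra of sections if the first
Čech cohomology with coefficients in the group with two elements is trivial. -/
theorem exists_isLieComplexStructure_section [FiniteDimensional ℝ E]
    [IsManifold 𝓘(ℝ, E) ∞ M] [T2Space M] [SigmaCompactSpace M] [Nontrivial 𝔨]
    (h_indec : IsIndecomposableLie 𝔨)
    (hk : (⁅(⊤ : LieIdeal ℝ 𝔨), (⊤ : LieIdeal ℝ 𝔨)⁆ : LieIdeal ℝ 𝔨) = ⊤ ∨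
      ∀ z : 𝔨, (∀ x : 𝔨, ⁅x, z⁆ = 0) → z = 0)
    (hH : Subsingleton (Cech.H1 M (Multiplicative (ZMod 2))))
    {J : 𝔨 →ₗ[ℝ] 𝔨} (hJ : IsLieComplexStructure J) :
    ∃ J' : Cₛ^k⟮𝓘(ℝ, E); 𝔨, 𝕃⟯ →ₗ[ℝ] Cₛ^k⟮𝓘(ℝ, E); 𝔨, 𝕃⟯, IsLieComplexStructure J' := by
  -- The cover is a set of open sets, so one chart is chosen for each domain.
  let 𝔙 : Cech.Cover M :=
    { sets := {U | ∃ e : Trivialization 𝔨 (π 𝔨 𝕃), IsLieBundleChart 𝓘(ℝ, E) e ∧ e.baseSet = U}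
      covers := fun x ↦ by
        obtain ⟨e, hx, he⟩ := hL.exists_chart x
        exact ⟨⟨e.baseSet, e.open_baseSet⟩, ⟨e, he, rfl⟩, hx⟩ }
  choose e he heU using fun U : 𝔙.sets ↦ U.2
  have hmem {U : 𝔙.sets} {x : M} (hx : x ∈ (U : Opens M)) : x ∈ (e U).baseSet := by
    rw [heU]; exact hx
  let j (U : 𝔙.sets) (x : M) : 𝕃 x →ₗ[ℝ] 𝕃 x := (he U).pullbackEnd J x
  have hj {U : 𝔙.sets} {x : M} (hx : x ∈ (U : Opens M)) : IsLieComplexStructure (j U x) :=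
    (he U).isLieComplexStructure_pullbackEnd hJ (hmem hx)
  let ε (V U : 𝔙.sets) (x : M) : Multiplicative (ZMod 2) :=
    if j V x = j U x then 1 else Multiplicative.ofAdd 1
  have hε (V U : 𝔙.sets) {x : M} (hV : x ∈ (V : Opens M)) (hU : x ∈ (U : Opens M)) :
      j V x = zmodTwoSign (ε V U x) • j U x := by
    by_cases h : j V x = j U x
    · simp only [ε, if_pos h, zmodTwoSign_one, one_smul]
      exact h
    · simp only [ε, if_neg h, zmodTwoSign_ofAdd_one, neg_smul, one_smul]
      exact (IsLieComplexStructure.eq_or_eq_neg_of_lieEquiv ((he U).lieEquivAt (hmem hU)) h_indec hk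
        (hj hU) (hj hV)).resolve_left h
  -- Nonvanishing makes the sign relating two structures unique, which yields the cocycle identity.
  have hne {U : 𝔙.sets} {x : M} (hx : x ∈ (U : Opens M)) : j U x ≠ 0 := by
    intro h0
    obtain ⟨v, hv⟩ := exists_ne (0 : 𝔨)
    have h1 := (hj hx).2 (((he U).lieEquivAt (hmem hx)).symm v)
    rw [h0, LinearMap.zero_apply, eq_comm, neg_eq_zero] at h1
    exact hv (((he U).lieEquivAt (hmem hx)).symm.injective
      (h1.trans (map_zero ((he U).lieEquivAt (hmem hx)).symm).symm))
  let g : Cech.Cocycle (Multiplicative (ZMod 2)) 𝔙 :=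
    { g := fun V U ↦ ⟨fun x ↦ ε V U x, IsLocallyConstant.of_eventually_subtype fun x hx ↦ by
        filter_upwards [(he V).eventually_pullbackEnd_eq_iff h_indec hk (he U) hJ
          (hmem hx.1) (hmem hx.2)] with y hy _
        exact if_congr hy rfl rfl⟩
      cocycle := fun U V W x hU hV hW ↦ by
        change ε V U x * ε U W x * ε W V x = 1
        refine eq_one_of_zmodTwoSign_eq_one ?_
        have h1 : zmodTwoSign (ε V U x * ε U W x * ε W V x) • j V x = j V x := by
          rw [zmodTwoSign_mul, zmodTwoSign_mul, mul_smul, mul_smul, ← hε W V hW hV,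
            ← hε U W hU hW, ← hε V U hV hU]
        exact smul_left_injective ℝ (hne hV) (h1.trans (one_smul ℝ (j V x)).symm) }
  obtain ⟨h, hh⟩ := Cech.isCoboundary_of_subsingleton_H1 (by decide) hH g
  choose w hw hwx using 𝔙.covers
  let W (x : M) : 𝔙.sets := ⟨w x, hw x⟩
  -- Since `ε V U = h V * (h U)⁻¹` and signs square to `1`, the corrected structures agree on
  -- overlaps.
  have hglue (U V : 𝔙.sets) (x : M) (hU : x ∈ (U : Opens M)) (hV : x ∈ (V : Opens M)) :
      zmodTwoSign (h V ⟨x, hV⟩) • j V x = zmodTwoSign (h U ⟨x, hU⟩) • j U x := by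
    have h1 : ε V U x * h U ⟨x, hU⟩ = h V ⟨x, hV⟩ := eq_mul_inv_iff_mul_eq.1 (hh U V x hU hV)
    rw [← h1, hε V U hV hU, smul_smul, zmodTwoSign_mul, mul_right_comm, zmodTwoSign_mul_self,
      one_mul]
  refine exists_isLieComplexStructure_of_fibrewise
    (fun x ↦ zmodTwoSign (h (W x) ⟨x, hwx x⟩) • j (W x) x)
    (fun x ↦ (hj (hwx x)).zmodTwoSign_smul _) fun X x ↦ ?_
  have h1 : ContMDiffAt 𝓘(ℝ, E) (𝓘(ℝ, E).prod 𝓘(ℝ, 𝔨)) k (fun y ↦ TotalSpace.mk' 𝔨 y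
      (zmodTwoSign (h (W x) ⟨x, hwx x⟩) • j (W x) y (X y))) x :=
    ((he (W x)).contMDiffAt_pullbackEnd J (hmem (hwx x)) (X.contMDiff x)).const_smul_section
  refine h1.congr_of_eventuallyEq ?_
  filter_upwards [(w x).isOpen.mem_nhds (hwx x),
    (h (W x)).eventually_eq_subtype (hwx x)] with y hy hhy
  have hy : y ∈ w x := hy
  refine congrArg (TotalSpace.mk' 𝔨 y) ?_
  have h2 := LinearMap.congr_fun (hglue (W x) (W y) y hy (hwx y)) (X y)
  rw [hhy hy] at h2
  exact h2

end Existence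

/-! ### Main theorem -/

theorem mainTheorem9
    {E : Type*} [NormedAddCommGroup E] [NormedSpace ℝ E] [FiniteDimensional ℝ E]
    {M : Type*} [TopologicalSpace M] [ChartedSpace E M] [IsManifold 𝓘(ℝ, E) ∞ M]
    [T2Space M] [ParacompactSpace M] [ConnectedSpace M]
    {𝔨 : Type*} [NormedGroupLieRing 𝔨] [NormedSpaceLieAlgebra 𝔨] [FiniteDimensional ℝ 𝔨]
    {𝕃 : M → Type*} [TopologicalSpace (TotalSpace 𝔨 𝕃)] [∀ x, TopologicalSpace (𝕃 x)]
    [∀ x, LieRing (𝕃 x)] [∀ x, LieAlgebra ℝ (𝕃 x)]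
    [FiberBundle 𝔨 𝕃] [VectorBundle ℝ 𝔨 𝕃] [ContMDiffVectorBundle ∞ 𝔨 𝕃 𝓘(ℝ, E)]
    [IsLieAlgebraBundle 𝓘(ℝ, E) 𝔨 𝕃]
    (k : ℕ∞)
    (h_indec : IsIndecomposableLie 𝔨)
    (h_hom : ∀ f : (𝔨 ⧸ (⁅(⊤ : LieIdeal ℝ 𝔨), (⊤ : LieIdeal ℝ 𝔨)⁆ : LieIdeal ℝ 𝔨)) →ₗ⁅ℝ⁆
      LieAlgebra.center ℝ 𝔨, f = 0) :
    ({J : Cₛ^k⟮𝓘(ℝ, E); 𝔨, 𝕃⟯ →ₗ[ℝ] Cₛ^k⟮𝓘(ℝ, E); 𝔨, 𝕃⟯ |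
        IsLieComplexStructure J}.encard ≤ 2 ∧
      ∀ J : Cₛ^k⟮𝓘(ℝ, E); 𝔨, 𝕃⟯ →ₗ[ℝ] Cₛ^k⟮𝓘(ℝ, E); 𝔨, 𝕃⟯, IsLieComplexStructure J →
        {J' : Cₛ^k⟮𝓘(ℝ, E); 𝔨, 𝕃⟯ →ₗ[ℝ] Cₛ^k⟮𝓘(ℝ, E); 𝔨, 𝕃⟯ |
          IsLieComplexStructure J'} = {J, -J}) ∧
    (Subsingleton (Cech.H1 M (Multiplicative (ZMod 2))) →
      ((∃ J : Cₛ^k⟮𝓘(ℝ, E); 𝔨, 𝕃⟯ →ₗ[ℝ] Cₛ^k⟮𝓘(ℝ, E); 𝔨, 𝕃⟯, IsLieComplexStructure J) ↔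
        ∃ J₀ : 𝔨 →ₗ[ℝ] 𝔨, IsLieComplexStructure J₀)) := by
  have : LocallyCompactSpace M := ChartedSpace.locallyCompactSpace E M
  have : SigmaCompactSpace M := sigmaCompactSpace_of_connectedSpace M
  have hk := derived_eq_top_or_center_eq_bot h_hom
  have hset : ∀ J : Cₛ^k⟮𝓘(ℝ, E); 𝔨, 𝕃⟯ →ₗ[ℝ] Cₛ^k⟮𝓘(ℝ, E); 𝔨, 𝕃⟯, IsLieComplexStructure J →
      {J' : Cₛ^k⟮𝓘(ℝ, E); 𝔨, 𝕃⟯ →ₗ[ℝ] Cₛ^k⟮𝓘(ℝ, E); 𝔨, 𝕃⟯ |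
        IsLieComplexStructure J'} = {J, -J} := by
    refine fun J hJ ↦ Set.ext fun J' ↦ ⟨fun hJ' ↦ hJ.eq_or_eq_neg_of_section h_indec hk hJ', ?_⟩
    rintro (rfl | rfl)
    · exact hJ
    · exact hJ.neg
  refine ⟨⟨?_, hset⟩, fun hH ↦ ⟨?_, ?_⟩⟩
  · rcases Set.eq_empty_or_nonempty {J : Cₛ^k⟮𝓘(ℝ, E); 𝔨, 𝕃⟯ →ₗ[ℝ] Cₛ^k⟮𝓘(ℝ, E); 𝔨, 𝕃⟯ |
        IsLieComplexStructure J} with h | ⟨J, hJ⟩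
    · rw [h, Set.encard_empty]
      exact zero_le
    · rw [hset J hJ]
      refine (Set.encard_insert_le _ _).trans ?_
      rw [Set.encard_singleton]
      norm_num
  · rintro ⟨J, hJ⟩
    obtain ⟨j, hj, -⟩ := hJ.exists_fibrewise hk
    obtain ⟨x⟩ := (inferInstance : Nonempty M)
    obtain ⟨φ⟩ := IsLieAlgebraBundle.nonempty_lieEquiv (E := E) (𝔨 := 𝔨) (𝕃 := 𝕃) inferInstance x
    exact ⟨_, (hj x).conj φ⟩
  · rintro ⟨J₀, hJ₀⟩
    -- Over the zero algebra the sign `ε` is not determined, but `0` is itself a complex structure.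
    rcases subsingleton_or_nontrivial 𝔨 with h𝔨 | h𝔨
    · have hfib (x : M) : Subsingleton (𝕃 x) := by
        obtain ⟨φ⟩ := IsLieAlgebraBundle.nonempty_lieEquiv (E := E) (𝔨 := 𝔨) (𝕃 := 𝕃) inferInstance x
        exact φ.injective.subsingleton
      exact ⟨0, fun X Y ↦ ContMDiffSection.ext fun x ↦ Subsingleton.elim _ _,
        fun X ↦ ContMDiffSection.ext fun x ↦ Subsingleton.elim _ _⟩
    · exact exists_isLieComplexStructure_section h_indec hk hH hJ₀
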